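/- **Setting.** A finite set $\mathcal N$ of mobile devices. At each slot $t$ the channel state is $C(t)=(C^c(t),C^w(t))$, where $C^c(t)=(C^c_k(t))_k$ are the states of the cellular links and $C^w(t)$ is the state vector of the local links; the states $C(t)$ are i.i.d. over slots, with arbitrary common law. Cellular links do not interfere: in state $c$ a vector $(r_k)_k$ of cellular rates is feasible, $r\in\Gamma_{c}$, iff each $r_k$ is feasible for the state $c_k$ of link $k$. In local state $w$, the feasible unicast rates $(g_{k,n})_{k\ne n}$ form a set $\Gamma_{w}^{u}$, and the feasible broadcast rates $(f_{n,\mathcal J})_{n\notin \mathcal J\neq\emptyset}$ ($n$ sends to all of $\mathcal J\subset\mathcal N$) form a set $\Gamma_{w}^{b}$. Sets of feasible rates are compact, consist of nonnegative rates, contain $0$, contain with a rate vector all smaller nonnegative ones, depend measurably on the state (measurable graph) and are bounded uniformly in the state. For broadcast, traffic that can be sent by $n$ to $\mathcal J$ can also be addressed to a smaller nonempty set $\mathcal J'\subset\mathcal J$ at the same rate. The utilities $U_k:[0,\infty)\to\mathbb R$ are continuous and strictly concave. For a state-dependent family $\Gamma$ let $\overline\Gamma$ be the set of all expectations $E[r(C)]$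 with $r$ measurable and $r(c)\in\operatorname{conv}\Gamma_c$ almost surely. The bounds $R_k^{max}$ are not smaller than the total average cellular rate: $\sum_n r_n\le R_k^{max}$ for all $r\in\overline{\Gamma^c}$ and all $k$. Fix $\beta>0$. **Optimization problems.** P-Unicast: maximize $\sum_k U_k(y_k)$ over $y$ and nonnegative $g_{k,s}^n$ $(k,n\in\mathcal N)$, $g_{k,n}^k$ $(k\neq n)$ subject to $$g_{k,s}^k+\sum_{n\ne k}g_{k,n}^k=y_k,\qquad g_{n,s}^k=g_{k,n}^k\ (n\neq k),\qquad \bigl(\max_n g_{k,s}^n\bigr)_k\in\overline{\Gamma^c},\qquad (g_{k,n}^k)_{k\ne n}\in\overline{\Gamma^u}.$$ P-Broadcast: the same with the last constraint replaced by $g_{k,n}^k\le\sum_{\mathcal J:\,k\in \mathcal J,\,n\notin \mathcal J}f_{n,\mathcal J}$ for $k\neq n$ and $f\in\overline{\Gamma^b}$. **Algorithm DcC with parameter $M>0$.** There are nonnegative virtual queues $\lambda_k$, $\eta_{n,k}$ and nonnegative real queues $Q_{n,k}$ $(n\ne k)$ with square integrable initial values; the queues at slot $t$ are determined by a past that is independent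 of $C(t)$. In slot $t$: * $y_k(t)$ maximizes $MU_k(y)-\lambda_k(t)y$ subject to $0\le y\le R_k^{max}$; * $(g_{k,s}^n(t))_n\ge0$ maximizes $\lambda_k g_{k,s}^k+\sum_{n\ne k}(\eta_{k,n}-Q_{k,n})g_{k,s}^n$ subject to $\max_n g_{k,s}^n$ being feasible for the state $C^c_k(t)$; * unicast: $(g_{k,n}^k(t))_{k\neq n}$ maximizes $\sum_k\sum_{n\ne k}(\lambda_k-\eta_{n,k}+Q_{n,k})g_{k,n}^k$ over $\Gamma^u_{C^w(t)}$; broadcast: $f(t)$ maximizes $\sum_k\sum_{n\ne k}\sum_{\mathcal J:\,k\in \mathcal J,\,n\notin \mathcal J}(\lambda_k-\eta_{n,k}+Q_{n,k})f_{n,\mathcal J}$ over $\Gamma^b_{C^w(t)}$, and $g_{k,n}^k(t)=\sum_{\mathcal J:\,k\in \mathcal J,\,n\notin \mathcal J}f_{n,\mathcal J}(t)$. All decisions are random variables; ties may be broken in any way. With $o_k=g_{k,s}^k+\sum_{n\ne k}g_{k,n}^k$, the queues satisfy $$\lambda_k(t+1)=\max[\lambda_k-o_k,0]+y_k,$$ $$\max[\eta_{n,k}-g_{n,s}^k,0]+a_{k,n}\le\eta_{n,k}(t+1)\le\max[\eta_{n,k}-g_{n,s}^k,0]+g_{k,n}^k,$$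 $$Q_{n,k}(t+1)\le\max[Q_{n,k}-g_{k,n}^k,0]+\max[g_{n,s}^k-\beta,0]$$ (right-hand sides at slot $t$), where $0\le a_{k,k}\le g_{k,s}^k$ and $0\le a_{k,n}\le g_{k,n}^k$ $(n\ne k)$ are the amounts that actually leave $\lambda_k$, so that $\sum_n a_{k,n}=\min(\lambda_k,o_k)$. **Theorem 2.** In the unicast case (P-Unicast, unicast scheduler) and in the broadcast case (P-Broadcast, broadcast scheduler) alike: the problem has exactly one optimal rate vector $y^*$, and the admitted flow rates of DcC converge to $y^*$ as $M\to\infty$. That is, for every $\varepsilon>0$ there is $M_0>0$, which depends only on $\varepsilon$ and on the data of the system (the feasible rate sets, the law of the channel states, the $U_k$, $R_k^{max}$ and $\beta$), such that for every $M\ge M_0$ and every run of DcC with parameter $M$, for all sufficiently large $T$ and all $k$, $$\Bigl|\frac1T\sum_{t=0}^{T-1}E[y_k(t)]-y_k^*\Bigr|\le\varepsilon .$$ -/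

import Mathlib

open MeasureTheory ProbabilityTheory Filter Finset
open scoped Topology

namespace DcC

/-- Ordered pairs `(k, n)` of distinct devices: the local area links. -/
abbrev ULink (N : Type*) : Type _ := {p : N × N // p.1 ≠ p.2}

/-- Broadcast links `(n, J)`: a transmitter `n` and a nonempty set `J` of addressees, `n ∉ J`. -/
abbrev BLink (N : Type*) : Type _ := {p : N × Finset N // p.1 ∉ p.2 ∧ p.2.Nonempty}

/-- The data of a cooperative system with set of devices `N`, cellular link states in `S` and local
link states in `W`. -/
structure Network (N S W : Type*) where
  /-- Feasible rates of the cellular link of device `k`, for a given state of this link. -/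
  cell : N → S → Set ℝ
  /-- Feasible local rate vectors for unicast, for a given local channel state vector. -/
  uni : (ULink N → W) → Set (ULink N → ℝ)
  /-- Feasible local rate vectors for broadcast, for a given local channel state vector. -/
  bro : (ULink N → W) → Set (BLink N → ℝ)
  /-- Utility functions. -/
  U : N → ℝ → ℝ
  /-- Upper bounds on the admitted rates. -/
  Rmax : N → ℝ
  /-- The amount by which the real cellular rates stay below the virtual ones. -/
  β : ℝ

/-- The conditions on sets `Γ c` of feasible link rates, indexed by channel states `c`. -/
structure IsRateRegion {X E : Type*} [MeasurableSpace X] [MeasurableSpace E] [TopologicalSpace E]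
    [Zero E] [LE E] (Γ : X → Set E) : Prop where
  measurable_graph : MeasurableSet {p : X × E | p.2 ∈ Γ p.1}
  isCompact : ∀ c, IsCompact (Γ c)
  zero_mem : ∀ c, 0 ∈ Γ c
  nonneg : ∀ c, ∀ r ∈ Γ c, 0 ≤ r
  /-- A link may be used below a feasible rate. -/
  lower : ∀ c, ∀ r ∈ Γ c, ∀ r', 0 ≤ r' → r' ≤ r → r' ∈ Γ c
  bounded : ∃ G : E, ∀ c, ∀ r ∈ Γ c, r ≤ G

/-- The long-term average region of state-dependent sets of feasible rates when the state has law `ν`: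
the expectations of the (time-shared) state-dependent choices of rates. -/
def avgRegion {X E : Type*} [MeasurableSpace X] [MeasurableSpace E] [NormedAddCommGroup E]
    [NormedSpace ℝ E] (ν : Measure X) (Γ : X → Set E) : Set E :=
  {v | ∃ r : X → E, Measurable r ∧ Integrable r ν ∧ (∀ᵐ c ∂ν, r c ∈ convexHull ℝ (Γ c)) ∧
    v = ∫ c, r c ∂ν}

section Model

variable {N S W : Type*} [Fintype N] [DecidableEq N]

/-- Cellular links do not interfere: a vector of cellular rates is feasible iff each entry is. -/
def Network.cellVec (net : Network N S W) (c : N → S) : Set (N → ℝ) :=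
  {r | ∀ k, r k ∈ net.cell k (c k)}

/-- The rate `∑_{J | k ∈ J, n ∉ J} f_{n,J}` at which device `k` is served by broadcasts of `n`. -/
def linkRate (f : BLink N → ℝ) (k n : N) : ℝ :=
  ∑ e : BLink N, if e.1.1 = n ∧ k ∈ e.1.2 then f e else 0

/-- The broadcast rates obtained from `f` when all that is sent on `e` is sent on `e'` instead. -/
def moveTo (f : BLink N → ℝ) (e e' : BLink N) : BLink N → ℝ :=
  Function.update (Function.update f e 0) e' (f e' + f e)

/-- What can be broadcast to a set of devices can be addressed to fewer of them only. -/
def CanDropAddressees {X : Type*} (Γ : X → Set (BLink N → ℝ)) : Prop :=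
  ∀ c, ∀ f ∈ Γ c, ∀ e e' : BLink N, e'.1.1 = e.1.1 → e'.1.2 ⊂ e.1.2 → moveTo f e e' ∈ Γ c

/-! ### The two network utility maximization problems

`gs k n` is `g_{k,s}^n` and `gl k n` is `g_{k,n}^k` (used for `k ≠ n` only). -/

/-- The constraints that P-Unicast and P-Broadcast share; `νc` is the law of the cellular state. -/
structure CommonConstraints [MeasurableSpace S] (net : Network N S W) (νc : Measure (N → S))
    (y : N → ℝ) (gs gl : N → N → ℝ) : Prop where
  gs_nonneg : ∀ k n, 0 ≤ gs k n
  gl_nonneg : ∀ k n, k ≠ n → 0 ≤ gl k n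
  conservation : ∀ k, gs k k + ∑ n ∈ univ.erase k, gl k n = y k
  relay : ∀ k n, n ≠ k → gs n k = gl k n
  cellular : (fun k => ⨆ n, gs k n) ∈ avgRegion νc net.cellVec

/-- `y` satisfies the constraints of P-Unicast together with suitable link rates. -/
def UnicastFeasible [MeasurableSpace S] [MeasurableSpace W] (net : Network N S W)
    (νc : Measure (N → S)) (νw : Measure (ULink N → W)) (y : N → ℝ) : Prop :=
  ∃ gs gl : N → N → ℝ, CommonConstraints net νc y gs gl ∧
    (fun e : ULink N => gl e.1.1 e.1.2) ∈ avgRegion νw net.uni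

/-- `y` satisfies the constraints of P-Broadcast together with suitable link rates. -/
def BroadcastFeasible [MeasurableSpace S] [MeasurableSpace W] (net : Network N S W)
    (νc : Measure (N → S)) (νw : Measure (ULink N → W)) (y : N → ℝ) : Prop :=
  ∃ (gs gl : N → N → ℝ) (f : BLink N → ℝ), CommonConstraints net νc y gs gl ∧
    (∀ k n, k ≠ n → gl k n ≤ linkRate f k n) ∧ f ∈ avgRegion νw net.bro

/-- `y` maximizes the total utility among the rate vectors that satisfy `Feasible`. -/
def IsUtilityOptimal (net : Network N S W) (Feasible : (N → ℝ) → Prop) (y : N → ℝ) : Prop :=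
  Feasible y ∧ ∀ z, Feasible z → ∑ k, net.U k (z k) ≤ ∑ k, net.U k (y k)

/-! ### The algorithm -/

/-- The objective of the cellular link scheduler of device `k`, as a function of
`v n = g_{k,s}^n`. -/
def cellObjective (lam : N → ℝ) (eta Q : N → N → ℝ) (k : N) (v : N → ℝ) : ℝ :=
  lam k * v k + ∑ n ∈ univ.erase k, (eta k n - Q k n) * v n

/-- The objective of the local area scheduler, as a function of the rates `gl k n = g_{k,n}^k`. -/
def localObjective (lam : N → ℝ) (eta Q : N → N → ℝ) (gl : N → N → ℝ) : ℝ :=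
  ∑ k, ∑ n ∈ univ.erase k, (lam k - eta n k + Q n k) * gl k n

/-- The same objective for rates given on the local links. -/
def uniObjective (lam : N → ℝ) (eta Q : N → N → ℝ) (v : ULink N → ℝ) : ℝ :=
  ∑ e : ULink N, (lam e.1.1 - eta e.1.2 e.1.1 + Q e.1.2 e.1.1) * v e

/-- The processes that make up a run of the algorithm. -/
structure Run (N Ω : Type*) where
  /-- Virtual queues `λ_k`. -/
  lam : ℕ → Ω → N → ℝ
  /-- Virtual queues: `eta t ω n k` is `η_{n,k}(t)`, held at device `n` for `k ≠ n`. -/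
  eta : ℕ → Ω → N → N → ℝ
  /-- Real queues: `Q t ω n k` is `Q_{n,k}(t)`, held at device `n` for `k ≠ n`. -/
  Q : ℕ → Ω → N → N → ℝ
  /-- Admitted rates `y_k`. -/
  y : ℕ → Ω → N → ℝ
  /-- `gs t ω k n` is `g_{k,s}^n(t)`. -/
  gs : ℕ → Ω → N → N → ℝ
  /-- `gl t ω k n` is `g_{k,n}^k(t)`. -/
  gl : ℕ → Ω → N → N → ℝ
  /-- The amounts that actually leave `λ_k`: `a t ω k k` to the virtual sink and `a t ω k n` to
  device `n`. They can be smaller than the offered rates when the queue is nearly empty. -/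
  a : ℕ → Ω → N → N → ℝ

/-- The total service `g_{k,s}^k + ∑_{n ≠ k} g_{k,n}^k` offered to the virtual queue `λ_k`. -/
def offered (gs gl : N → N → ℝ) (k : N) : ℝ := gs k k + ∑ n ∈ univ.erase k, gl k n

/-- The queue dynamics. Real flows are `h_{n,k} = g_{k,n}^k` and `x_{n,k} = g_{n,s}^k - β`
(and `0` if this is negative). -/
structure QueueDynamics {Ω : Type*} (net : Network N S W) (R : Run N Ω) : Prop where
  lam_nonneg : ∀ t ω k, 0 ≤ R.lam t ω k
  eta_nonneg : ∀ t ω n k, n ≠ k → 0 ≤ R.eta t ω n k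
  Q_nonneg : ∀ t ω n k, n ≠ k → 0 ≤ R.Q t ω n k
  a_nonneg : ∀ t ω k n, 0 ≤ R.a t ω k n
  a_sink_le : ∀ t ω k, R.a t ω k k ≤ R.gs t ω k k
  a_link_le : ∀ t ω k n, k ≠ n → R.a t ω k n ≤ R.gl t ω k n
  a_total : ∀ t ω k,
    ∑ n, R.a t ω k n = min (R.lam t ω k) (offered (R.gs t ω) (R.gl t ω) k)
  lam_succ : ∀ t ω k, R.lam (t + 1) ω k =
    max (R.lam t ω k - offered (R.gs t ω) (R.gl t ω) k) 0 + R.y t ω k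
  /-- What arrives at `η_{n,k}` lies between the actual and the offered transfer. -/
  eta_succ_ge : ∀ t ω n k, n ≠ k →
    max (R.eta t ω n k - R.gs t ω n k) 0 + R.a t ω k n ≤ R.eta (t + 1) ω n k
  eta_succ_le : ∀ t ω n k, n ≠ k →
    R.eta (t + 1) ω n k ≤ max (R.eta t ω n k - R.gs t ω n k) 0 + R.gl t ω k n
  Q_succ_le : ∀ t ω n k, n ≠ k →
    R.Q (t + 1) ω n k ≤ max (R.Q t ω n k - R.gl t ω k n) 0 + max (R.gs t ω n k - net.β) 0

/-- The channel states `C t = (C^c(t), C^w(t))` are i.i.d. over time slots with law `ν`. -/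
structure IIDChannel {Ω : Type*} [MeasurableSpace Ω] [MeasurableSpace S] [MeasurableSpace W]
    (P : Measure Ω) (ν : Measure ((N → S) × (ULink N → W)))
    (C : ℕ → Ω → (N → S) × (ULink N → W)) : Prop where
  measurable : ∀ t, Measurable (C t)
  indep : iIndepFun C P
  law : ∀ t, P.map (C t) = ν

/-- The queues at the beginning of slot `t` are determined by the past `ℱ t`, which is independent
of the channel state of slot `t`; the decisions are random variables; and the initial queues have
finite second moments. -/
structure Causal {Ω : Type*} [mΩ : MeasurableSpace Ω] [MeasurableSpace S] [MeasurableSpace W]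
    (P : Measure Ω) (ℱ : Filtration ℕ mΩ) (C : ℕ → Ω → (N → S) × (ULink N → W))
    (R : Run N Ω) : Prop where
  lam_meas : ∀ t, Measurable[ℱ t] (R.lam t)
  eta_meas : ∀ t, Measurable[ℱ t] (R.eta t)
  Q_meas : ∀ t, Measurable[ℱ t] (R.Q t)
  indep : ∀ t, Indep (ℱ t) (MeasurableSpace.comap (C t) inferInstance) P
  y_meas : ∀ t, Measurable (R.y t)
  gs_meas : ∀ t, Measurable (R.gs t)
  gl_meas : ∀ t, Measurable (R.gl t)
  a_meas : ∀ t, Measurable (R.a t)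
  lam_init : ∀ k, MemLp (fun ω => R.lam 0 ω k) 2 P
  eta_init : ∀ n k, n ≠ k → MemLp (fun ω => R.eta 0 ω n k) 2 P
  Q_init : ∀ n k, n ≠ k → MemLp (fun ω => R.Q 0 ω n k) 2 P

/-- The rate controller with parameter `M`: `y_k(t)` maximizes `M U_k(y) - λ_k(t) y` subject to
`0 ≤ y ≤ R_k^max`. -/
def RateControl {Ω : Type*} (net : Network N S W) (M : ℝ) (R : Run N Ω) : Prop :=
  ∀ t ω k, R.y t ω k ∈ Set.Icc 0 (net.Rmax k) ∧
    IsMaxOn (fun v => M * net.U k v - R.lam t ω k * v) (Set.Icc 0 (net.Rmax k)) (R.y t ω k)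

/-- The admissible choices of `(g_{k,s}^n)_n` at device `k` when its cellular link is in state `s`:
the cellular link carries the maximum of these rates. -/
def Network.cellChoices (net : Network N S W) (k : N) (s : S) : Set (N → ℝ) :=
  {v | (∀ n, 0 ≤ v n) ∧ (⨆ n, v n) ∈ net.cell k s}

/-- The cellular link scheduler. -/
def CellScheduler {Ω : Type*} (net : Network N S W) (C : ℕ → Ω → (N → S) × (ULink N → W))
    (R : Run N Ω) : Prop :=
  ∀ t ω k, R.gs t ω k ∈ net.cellChoices k ((C t ω).1 k) ∧
    IsMaxOn (cellObjective (R.lam t ω) (R.eta t ω) (R.Q t ω) k)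
      (net.cellChoices k ((C t ω).1 k)) (R.gs t ω k)

/-- The local area scheduler for unicast. -/
def UnicastScheduler {Ω : Type*} (net : Network N S W) (C : ℕ → Ω → (N → S) × (ULink N → W))
    (R : Run N Ω) : Prop :=
  ∀ t ω, (fun e : ULink N => R.gl t ω e.1.1 e.1.2) ∈ net.uni (C t ω).2 ∧
    IsMaxOn (uniObjective (R.lam t ω) (R.eta t ω) (R.Q t ω)) (net.uni (C t ω).2)
      (fun e : ULink N => R.gl t ω e.1.1 e.1.2)

/-- The local area scheduler for broadcast: it chooses the broadcast rates `f_{n,J}(t)`, and then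
`g_{k,n}^k(t) = ∑_{J | k ∈ J, n ∉ J} f_{n,J}(t)`. -/
def BroadcastScheduler {Ω : Type*} [MeasurableSpace Ω] (net : Network N S W)
    (C : ℕ → Ω → (N → S) × (ULink N → W)) (R : Run N Ω) : Prop :=
  ∃ f : ℕ → Ω → BLink N → ℝ, (∀ t, Measurable (f t)) ∧
    ∀ t ω, f t ω ∈ net.bro (C t ω).2 ∧
      IsMaxOn (fun v => localObjective (R.lam t ω) (R.eta t ω) (R.Q t ω) (linkRate v))
        (net.bro (C t ω).2) (f t ω) ∧
      ∀ k n, k ≠ n → R.gl t ω k n = linkRate (f t ω) k n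

/-- A run of the algorithm with parameter `M` over i.i.d. channel states with law `ν`, up to the
choice of the local area scheduler. -/
structure IsRun {Ω : Type*} [mΩ : MeasurableSpace Ω] [MeasurableSpace S] [MeasurableSpace W]
    (net : Network N S W) (ν : Measure ((N → S) × (ULink N → W))) (M : ℝ) (P : Measure Ω)
    (ℱ : Filtration ℕ mΩ) (C : ℕ → Ω → (N → S) × (ULink N → W)) (R : Run N Ω) : Prop where
  channel : IIDChannel P ν C
  causal : Causal P ℱ C R
  dynamics : QueueDynamics net R
  rate : RateControl net M R
  cellular : CellScheduler net C R

/-- The expected admitted rate of device `k`, averaged over the first `T` slots. -/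
noncomputable def avgAdmitted {Ω : Type*} [MeasurableSpace Ω] (P : Measure Ω) (R : Run N Ω)
    (T : ℕ) (k : N) : ℝ :=
  (1 / (T : ℝ)) * ∑ t ∈ range T, ∫ ω, R.y t ω k ∂P

end Model

end DcC

/-! ### Compactness in finite dimension and in Hilbert space -/

namespace DcC

/-! The proof is a drift-plus-penalty argument that needs no slack in the constraints. Take as
energy the sum of the squares of all queues. In one slot it grows by at most a constant `B` plus
twice `∑ λ_k y_k` minus the objectives that the schedulers maximize (`BoundedRun.lyapunov_succ_le`).
Compare with a feasible vector `z`. The queues are independent of the current channel state, so in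
expectation the schedulers do at least as well as the average rates behind `z`
(`Causal.integral_sum_mul_le`). For those rates the weights of `η` and `Q` cancel, because relayed
traffic is conserved, and `∑ λ_k z_k` is left (`sum_cellObjective_add_uniObjective`). The rate
controller prefers `y_k` to `z_k`. Hence the expected energy grows per slot by at most `B + 2M (E
U(y) - U(z))` (`OptimalRun.integral_lyapunov_succ_le`).

This has two consequences. Since the energy is nonnegative, summation and Jensen's inequality give
average rates of utility at least `U(z) - δ` for large times, provided `B < 2Mδ`. Since utilities
are bounded on bounded rates, the energy grows at most linearly, so the expected queues are `o(T)`.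
The flow balances of `λ` and `η` then put the average rates within `δ` of a feasible vector
(`OptimalRun.eventually_near_feasible`).

The feasible rates form a compact convex set and the total utility is strictly concave, so there is
exactly one optimum, and nearly feasible vectors of nearly optimal utility lie near it
(`exists_near_maximizer_dist_le`). Neither `δ` nor the threshold for `M` depends on the run.

Two points need care. Closedness of the long-term average region comes from viewing it as the image
of a closed, convex, bounded set of `L²` selections. And P-Broadcast lets local rates stay below
what the broadcasts serve, while the scheduler counts every addressee, even one of negative weight;
dropping addressees closes this gap (`exists_drop_addressees`). -/

theorem isCompact_convexHull_of_finiteDimensional {E : Type*} [NormedAddCommGroup E]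
    [NormedSpace ℝ E] [FiniteDimensional ℝ E] {s : Set E} (hs : IsCompact s) :
    IsCompact (convexHull ℝ s) := by
  rcases s.eq_empty_or_nonempty with rfl | ⟨x₀, hx₀⟩
  · simp
  set d := Module.finrank ℝ E + 1
  have himg : convexHull ℝ s = (fun p : (Fin d → ℝ) × (Fin d → E) => ∑ i, p.1 i • p.2 i) ''
      (stdSimplex ℝ (Fin d) ×ˢ Set.pi Set.univ (fun _ => s)) := by
    apply Set.Subset.antisymm
    · intro x hx
      obtain ⟨ι, hι, z, w, hz, hind, hw, hw1, hwx⟩ := eq_pos_convex_span_of_mem_convexHull hx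
      have hcard : Fintype.card ι ≤ Fintype.card (Fin d) := by
        rw [Fintype.card_fin]
        exact hind.card_le_finrank_succ.trans
          (Nat.succ_le_succ (Submodule.finrank_le _))
      obtain ⟨e⟩ := Function.Embedding.nonempty_of_card_le hcard
      have hw' : ∀ i, Function.extend e w 0 (e i) = w i := fun i => e.injective.extend_apply _ _ _
      have hz' : ∀ i, Function.extend e z (fun _ => x₀) (e i) = z i :=
        fun i => e.injective.extend_apply _ _ _
      have hout : ∀ j, j ∉ Set.range e → Function.extend e w 0 j = 0 := fun j hj =>
        Function.extend_apply' _ _ _ (by simpa using hj)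
      -- Carathéodory bounds the number of points by the dimension plus one; the unused slots get
      -- weight zero and the dummy point `x₀`.
      refine ⟨(Function.extend e w 0, Function.extend e z (fun _ => x₀)), ⟨⟨?_, ?_⟩, ?_⟩, ?_⟩
      · intro j
        by_cases hj : j ∈ Set.range e
        · obtain ⟨i, rfl⟩ := hj
          simpa [hw'] using (hw i).le
        · exact (hout j hj).ge
      · rw [← hw1]
        symm
        apply Finset.sum_of_injOn e e.injective.injOn (by simp)
        · intro j _ hj
          exact hout j (by simpa using hj)
        · intro i _
          exact (hw' i).symm
      · intro j _
        by_cases hj : j ∈ Set.range e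
        · obtain ⟨i, rfl⟩ := hj
          simp only [hz']
          exact hz ⟨i, rfl⟩
        · simp only
          rw [Function.extend_apply' _ _ _ (by simpa using hj)]
          exact hx₀
      · rw [← hwx]
        symm
        apply Finset.sum_of_injOn e e.injective.injOn (by simp)
        · intro j _ hj
          simp [hout j (by simpa using hj)]
        · intro i _
          simp [hw', hz']
    · rintro _ ⟨p, ⟨⟨h0, h1⟩, hp⟩, rfl⟩
      exact (convex_convexHull ℝ s).sum_mem (fun i _ => h0 i) h1
        (fun i _ => subset_convexHull ℝ s (hp i (Set.mem_univ i)))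
  rw [himg]
  refine ((isCompact_stdSimplex ℝ (Fin d)).prod (isCompact_univ_pi fun _ => hs)).image ?_
  fun_prop

/-- A continuous linear map sends closed convex bounded sets of a Hilbert space to closed sets. -/
theorem isClosed_image_of_convex_bounded {H V : Type*} [NormedAddCommGroup H]
    [InnerProductSpace ℝ H] [CompleteSpace H] [NormedAddCommGroup V] [NormedSpace ℝ V]
    (A : H →L[ℝ] V) {K : Set H} (hc : IsClosed K) (hconv : Convex ℝ K) {b : ℝ}
    (hb : ∀ x ∈ K, ‖x‖ ≤ b) : IsClosed (A '' K) := by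
  refine isClosed_of_closure_subset fun v hv => ?_
  -- The elements of least norm in these nested closed convex sets have monotone bounded norms. By
  -- the parallelogram law they form a Cauchy sequence, whose limit is a preimage of `v`; no weak
  -- topology is involved.
  set D : ℕ → Set H := fun n => K ∩ A ⁻¹' Metric.closedBall v (1 / ((n : ℝ) + 1)) with hD
  have hDne : ∀ n, (D n).Nonempty := by
    intro n
    obtain ⟨_, ⟨x, hx, rfl⟩, hxv⟩ := Metric.mem_closure_iff.1 hv (1 / ((n : ℝ) + 1)) (by positivity)
    exact ⟨x, hx, by simpa [dist_comm] using hxv.le⟩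
  have hDc : ∀ n, IsClosed (D n) := fun n =>
    hc.inter (Metric.isClosed_closedBall.preimage A.continuous)
  have hDconv : ∀ n, Convex ℝ (D n) := fun n =>
    hconv.inter ((convex_closedBall v _).linear_preimage A.toLinearMap)
  have hDanti : ∀ m n, m ≤ n → D n ⊆ D m := fun m n hmn x hx =>
    ⟨hx.1, Metric.closedBall_subset_closedBall (by gcongr) hx.2⟩
  have hmin : ∀ n, ∃ p ∈ D n, ∀ x ∈ D n, ‖p‖ ≤ ‖x‖ := by
    intro n
    obtain ⟨p, hp, hpi⟩ := exists_norm_eq_iInf_of_complete_convex (hDne n) (hDc n).isComplete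
      (hDconv n) 0
    refine ⟨p, hp, fun x hx => ?_⟩
    simp only [zero_sub, norm_neg] at hpi
    rw [hpi]
    exact ciInf_le ⟨0, by rintro _ ⟨y, rfl⟩; positivity⟩ (⟨x, hx⟩ : D n)
  choose p hpD hpmin using hmin
  have hmono : Monotone fun n => ‖p n‖ ^ 2 := fun m n hmn => by
    have := hpmin m (p n) (hDanti m n hmn (hpD n))
    simp only
    gcongr
  have hbdd : BddAbove (Set.range fun n => ‖p n‖ ^ 2) := by
    refine ⟨b ^ 2, ?_⟩
    rintro _ ⟨n, rfl⟩
    have := hb _ (hpD n).1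
    simp only
    gcongr
  have hlim := tendsto_atTop_ciSup hmono hbdd
  -- The midpoint of `p n` and `p m` still lies in `D m`, so its norm is at least that of `p m`.
  have hpar : ∀ m n, m ≤ n → ‖p n - p m‖ ^ 2 ≤ 2 * (‖p n‖ ^ 2 - ‖p m‖ ^ 2) := by
    intro m n hmn
    have hmem : (1 / 2 : ℝ) • p n + (1 / 2 : ℝ) • p m ∈ D m :=
      hDconv m (hDanti m n hmn (hpD n)) (hpD m) (by norm_num) (by norm_num) (by norm_num)
    have h1 := hpmin m _ hmem
    rw [← smul_add, norm_smul] at h1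
    have h2 := parallelogram_law_with_norm ℝ (p n) (p m)
    have h3 : 2 * ‖p m‖ ≤ ‖p n + p m‖ := by
      norm_num at h1; linarith
    nlinarith [norm_nonneg (p m), norm_nonneg (p n + p m)]
  have hcauchy : CauchySeq p := by
    rw [Metric.cauchySeq_iff']
    intro ε hε
    obtain ⟨m, hm⟩ := (hlim.eventually (lt_mem_nhds
      (show (⨆ n, ‖p n‖ ^ 2) - ε ^ 2 / 4 < _ by linarith [sq_pos_of_pos hε]))).exists
    refine ⟨m, fun n hn => ?_⟩
    have h1 := hpar m n hn
    have h2 := le_ciSup hbdd n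
    rw [dist_eq_norm]
    refine lt_of_pow_lt_pow_left₀ 2 hε.le ?_
    nlinarith [sq_pos_of_pos hε]
  obtain ⟨x, hx⟩ := cauchySeq_tendsto_of_complete hcauchy
  refine ⟨x, hc.mem_of_tendsto hx (Eventually.of_forall fun n => (hpD n).1), ?_⟩
  have h1 : Tendsto (fun n => A (p n)) atTop (𝓝 (A x)) := (A.continuous.tendsto x).comp hx
  have h2 : Tendsto (fun n => A (p n)) atTop (𝓝 v) := by
    rw [tendsto_iff_dist_tendsto_zero]
    exact squeeze_zero (fun _ => dist_nonneg) (fun n => (hpD n).2)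
      tendsto_one_div_add_atTop_nhds_zero_nat
  exact tendsto_nhds_unique h1 h2

/-! ### Long-term average regions -/

section Region

variable {X ι : Type*} [MeasurableSpace X] {Γ : X → Set (ι → ℝ)}

theorem IsRateRegion.convexHull_le (hΓ : IsRateRegion Γ) :
    ∃ G : ι → ℝ, ∀ c, convexHull ℝ (Γ c) ⊆ Set.Icc 0 G := by
  obtain ⟨G, hG⟩ := hΓ.bounded
  exact ⟨G, fun c => convexHull_min (fun r hr => ⟨hΓ.nonneg c r hr, hG c r hr⟩) (convex_Icc _ _)⟩

/-- Scaling the coordinates by factors in `[0, 1]`. -/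
theorem IsRateRegion.mul_mem_convexHull (hΓ : IsRateRegion Γ) {s : ι → ℝ} (h0 : 0 ≤ s)
    (h1 : s ≤ 1) {c : X} {r : ι → ℝ} (hr : r ∈ convexHull ℝ (Γ c)) :
    s * r ∈ convexHull ℝ (Γ c) := by
  have h := Set.mem_image_of_mem (LinearMap.mulLeft ℝ s) hr
  rw [LinearMap.image_convexHull] at h
  refine convexHull_mono ?_ h
  rintro _ ⟨q, hq, rfl⟩
  have hq0 := hΓ.nonneg c q hq
  refine hΓ.lower c q hq _ (mul_nonneg h0 hq0) fun i => ?_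
  exact mul_le_of_le_one_left (hq0 i) (h1 i)

variable [Fintype ι] {ν : Measure X}

theorem IsRateRegion.zero_mem_avgRegion (hΓ : IsRateRegion Γ) : 0 ∈ avgRegion ν Γ :=
  ⟨0, measurable_zero, integrable_zero _ _ _,
    Eventually.of_forall fun c => subset_convexHull ℝ _ (hΓ.zero_mem c), by simp⟩

theorem convex_avgRegion : Convex ℝ (avgRegion ν Γ) := by
  rintro _ ⟨r, hr, hri, hrΓ, rfl⟩ _ ⟨q, hq, hqi, hqΓ, rfl⟩ a b ha hb hab
  refine ⟨fun c => a • r c + b • q c, by fun_prop, (hri.smul a).add (hqi.smul b), ?_, ?_⟩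
  · filter_upwards [hrΓ, hqΓ] with c h1 h2 using convex_convexHull ℝ _ h1 h2 ha hb hab
  · exact ((integral_add (hri.smul a) (hqi.smul b)).trans
      (congrArg₂ (· + ·) (integral_smul a r) (integral_smul b q))).symm

theorem integral_apply_of_integrable {r : X → ι → ℝ} (hr : Integrable r ν) (i : ι) :
    (∫ c, r c ∂ν) i = ∫ c, r c i ∂ν := by
  rw [eval_integral fun i => hr.eval i]

/-- Scaling coordinate `i` of the selection by the constant `w i / v i` in `[0, 1]` keeps it in the
convex hulls and turns its mean into `w`. -/
theorem IsRateRegion.lower_avgRegion (hΓ : IsRateRegion Γ) {v w : ι → ℝ}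
    (hv : v ∈ avgRegion ν Γ) (hw : 0 ≤ w) (hwv : w ≤ v) : w ∈ avgRegion ν Γ := by
  obtain ⟨r, hr, hri, hrΓ, rfl⟩ := hv
  set v := ∫ c, r c ∂ν with hv
  have hint : Integrable (fun c => (w / v) * r c) ν :=
    Integrable.of_eval fun i => (hri.eval i).const_mul _
  refine ⟨fun c => (w / v) * r c, by fun_prop, hint, ?_, ?_⟩
  · filter_upwards [hrΓ] with c hc
    refine hΓ.mul_mem_convexHull (fun i => ?_) (fun i => ?_) hc
    · exact div_nonneg (hw i) ((hw i).trans (hwv i))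
    · exact div_le_one_of_le₀ (hwv i) ((hw i).trans (hwv i))
  · ext i
    rw [integral_apply_of_integrable hint]
    simp only [Pi.mul_apply, Pi.div_apply]
    rw [integral_const_mul, ← integral_apply_of_integrable hri, ← hv]
    -- If `v i = 0` the quotient has the default value `0`, which is right because then `w i = 0`.
    rcases eq_or_ne (v i) 0 with h | h
    · have : w i = 0 := le_antisymm (h ▸ hwv i) (hw i)
      simp [h, this]
    · field_simp

theorem IsRateRegion.avgRegion_le [IsProbabilityMeasure ν] (hΓ : IsRateRegion Γ) :
    ∃ G : ι → ℝ, avgRegion ν Γ ⊆ Set.Icc 0 G := by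
  obtain ⟨G, hG⟩ := hΓ.convexHull_le
  refine ⟨G, ?_⟩
  rintro _ ⟨r, hr, hri, hrΓ, rfl⟩
  exact (convex_Icc 0 G).integral_mem isClosed_Icc (hrΓ.mono fun c hc => hG c hc) hri

theorem IsRateRegion.isCompact_convexHull (hΓ : IsRateRegion Γ) (c : X) :
    IsCompact (convexHull ℝ (Γ c)) :=
  isCompact_convexHull_of_finiteDimensional (hΓ.isCompact c)

/-- Selections are uniformly bounded, hence lie in `L²`, where they form a closed convex bounded set
`K`. The expectation is a continuous linear map on `L²`, and the region is the image of `K`. -/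
theorem IsRateRegion.isClosed_avgRegion [IsProbabilityMeasure ν] (hΓ : IsRateRegion Γ) :
    IsClosed (avgRegion ν Γ) := by
  classical
  obtain ⟨G, hG⟩ := hΓ.convexHull_le
  let H := Lp (EuclideanSpace ℝ ι) 2 ν
  let K : Set H := {f | ∀ᵐ c ∂ν, WithLp.ofLp (f c) ∈ convexHull ℝ (Γ c)}
  -- The mean of coordinate `i`, written as the inner product with the constant function `e_i`.
  let A : H →L[ℝ] (ι → ℝ) := ContinuousLinearMap.pi fun i =>
    innerSL ℝ (indicatorConstLp 2 MeasurableSet.univ (measure_ne_top ν _)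
      (EuclideanSpace.single i (1 : ℝ)))
  have hint : ∀ f : H, Integrable f ν := fun f => (Lp.memLp f).integrable (by norm_num)
  have hA : ∀ (f : H) i, A f i = ∫ c, f c i ∂ν := by
    intro f i
    simp only [A, ContinuousLinearMap.coe_pi', innerSL_apply_apply]
    rw [L2.inner_indicatorConstLp_eq_inner_setIntegral, Measure.restrict_univ,
      EuclideanSpace.inner_single_left]
    simp only [map_one, one_mul]
    exact ((EuclideanSpace.proj (𝕜 := ℝ) i).integral_comp_comm (hint f)).symm
  -- An `L²` limit is an almost everywhere limit along a subsequence, and each convex hull is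
  -- closed.
  have hKc : IsClosed K := by
    refine IsSeqClosed.isClosed fun f g hf hfg => ?_
    obtain ⟨ns, -, hns⟩ := (tendstoInMeasure_of_tendsto_Lp hfg).exists_seq_tendsto_ae
    have hall : ∀ᵐ c ∂ν, ∀ n, WithLp.ofLp (f n c) ∈ convexHull ℝ (Γ c) := ae_all_iff.2 hf
    filter_upwards [hns, hall] with c h1 h2
    have h3 : Tendsto (fun n => WithLp.ofLp (f (ns n) c)) atTop (𝓝 (WithLp.ofLp (g c))) :=
      ((PiLp.continuous_ofLp 2 _).tendsto _).comp h1
    exact (hΓ.isCompact_convexHull c).isClosed.mem_of_tendsto h3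
      (Eventually.of_forall fun n => h2 _)
  have hKconv : Convex ℝ K := by
    intro f hf g hg a b ha hb hab
    filter_upwards [hf, hg, Lp.coeFn_add (a • f) (b • g), Lp.coeFn_smul a f, Lp.coeFn_smul b g]
      with c h1 h2 h3 h4 h5
    rw [h3, Pi.add_apply, h4, h5]
    exact convex_convexHull ℝ _ h1 h2 ha hb hab
  have hnorm : ∀ x : EuclideanSpace ℝ ι, WithLp.ofLp x ∈ Set.Icc 0 G →
      ‖x‖ ≤ ‖(WithLp.toLp 2 G : EuclideanSpace ℝ ι)‖ := by
    intro x hx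
    rw [EuclideanSpace.norm_eq, EuclideanSpace.norm_eq]
    refine Real.sqrt_le_sqrt (Finset.sum_le_sum fun i _ => ?_)
    have h1 := hx.1 i
    have h2 := hx.2 i
    simp only [Real.norm_eq_abs, sq_abs]
    simp only [Pi.zero_apply] at h1
    gcongr
  have hKb : ∀ f ∈ K, ‖f‖ ≤ ‖(WithLp.toLp 2 G : EuclideanSpace ℝ ι)‖ := by
    intro f hf
    have h : ∀ᵐ c ∂ν, ‖f c‖ ≤ ‖(WithLp.toLp 2 G : EuclideanSpace ℝ ι)‖ := by
      filter_upwards [hf] with c hc using hnorm _ (hG c hc)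
    have := Lp.norm_le_of_ae_bound (norm_nonneg _) h
    simpa [measureUnivNNReal] using this
  have himg : avgRegion ν Γ = A '' K := by
    apply Set.Subset.antisymm
    · rintro _ ⟨r, hr, hri, hrΓ, rfl⟩
      have hmem : MemLp (fun c => (WithLp.toLp 2 (r c) : EuclideanSpace ℝ ι)) 2 ν := by
        refine MemLp.of_bound ?_ ‖(WithLp.toLp 2 G : EuclideanSpace ℝ ι)‖
          (hrΓ.mono fun c hc => hnorm _ (hG c hc))
        exact ((PiLp.continuous_toLp 2 _).measurable.comp hr).aestronglyMeasurable
      refine ⟨hmem.toLp _, ?_, ?_⟩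
      · filter_upwards [hmem.coeFn_toLp, hrΓ] with c h1 h2
        rw [h1]
        exact h2
      · ext i
        rw [hA, integral_apply_of_integrable hri]
        refine integral_congr_ae ?_
        filter_upwards [hmem.coeFn_toLp] with c h1
        rw [h1]
    · rintro _ ⟨f, hf, rfl⟩
      have hfi : Integrable (fun c => WithLp.ofLp (f c)) ν :=
        Integrable.of_eval fun i => (EuclideanSpace.proj (𝕜 := ℝ) i).integrable_comp (hint f)
      refine ⟨fun c => WithLp.ofLp (f c),
        (PiLp.continuous_ofLp 2 _).measurable.comp (Lp.stronglyMeasurable f).measurable, hfi, hf, ?_⟩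
      ext i
      rw [hA, integral_apply_of_integrable hfi]
  rw [himg]
  exact isClosed_image_of_convex_bounded A hKc hKconv hKb

theorem IsRateRegion.isCompact_avgRegion [IsProbabilityMeasure ν] (hΓ : IsRateRegion Γ) :
    IsCompact (avgRegion ν Γ) := by
  obtain ⟨G, hG⟩ := hΓ.avgRegion_le (ν := ν)
  exact isCompact_Icc.of_isClosed_subset hΓ.isClosed_avgRegion hG

/-- Expectations of random choices of feasible rates belong to the long-term average region. -/
theorem IsRateRegion.integral_mem_avgRegion (hΓ : IsRateRegion Γ) {Ω : Type*} [MeasurableSpace Ω]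
    {P : Measure Ω} [IsProbabilityMeasure P] {Z : Ω → X} (hZ : Measurable Z) {g : Ω → ι → ℝ}
    (hg : Measurable g) (hgΓ : ∀ ω, g ω ∈ Γ (Z ω)) : ∫ ω, g ω ∂P ∈ avgRegion (P.map Z) Γ := by
  obtain ⟨G, hG⟩ := hΓ.convexHull_le
  have hbound : ∀ x ∈ Set.Icc 0 G, ‖x‖ ≤ ‖G‖ := fun x hx =>
    (pi_norm_le_iff_of_nonneg (norm_nonneg _)).2 fun i => by
      have h1 := hx.1 i
      have h2 := hx.2 i
      simp only [Pi.zero_apply] at h1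
      rw [Real.norm_of_nonneg h1]
      exact h2.trans ((le_abs_self _).trans (norm_le_pi_norm G i))
  have hgi : Integrable g P := Integrable.of_bound hg.aestronglyMeasurable ‖G‖
    (Eventually.of_forall fun ω => hbound _ (hG _ (subset_convexHull ℝ _ (hgΓ ω))))
  have hprob : IsProbabilityMeasure (P.map Z) := Measure.isProbabilityMeasure_map hZ.aemeasurable
  -- A decision may use randomness beyond the channel state, for instance to break ties. The
  -- barycentre of its conditional law given the state is a selection from the convex hulls with the
  -- same mean; the measurable graph makes this law live on `Γ c` for almost every `c`.
  set κ := condDistrib g Z P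
  have hκ : P.map Z ⊗ₘ κ = P.map fun ω => (Z ω, g ω) := compProd_map_condDistrib hg.aemeasurable
  have hpair : Measurable fun ω => (Z ω, g ω) := hZ.prodMk hg
  have hae : ∀ᵐ c ∂P.map Z, ∀ᵐ x ∂κ c, x ∈ Γ c := by
    have : ∀ᵐ p ∂(P.map Z ⊗ₘ κ), p.2 ∈ Γ p.1 := by
      rw [hκ, ae_map_iff hpair.aemeasurable hΓ.measurable_graph]
      exact Eventually.of_forall hgΓ
    exact Measure.ae_ae_of_ae_compProd this
  have hsnd : Integrable (fun p : X × (ι → ℝ) => p.2) (P.map Z ⊗ₘ κ) := by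
    rw [hκ, integrable_map_measure measurable_snd.aestronglyMeasurable hpair.aemeasurable]
    exact hgi
  have hmeas : Measurable fun c => ∫ x, x ∂κ c :=
    (measurable_snd.stronglyMeasurable.integral_kernel_prod_right
      (f := fun (_ : X) (x : ι → ℝ) => x) (κ := κ)).measurable
  refine ⟨fun c => ∫ x, x ∂κ c, hmeas, ?_, ?_, ?_⟩
  · exact hsnd.integral_compProd
  · filter_upwards [hae] with c hc
    refine (convex_convexHull ℝ (Γ c)).integral_mem (hΓ.isCompact_convexHull c).isClosed
      (hc.mono fun x hx => subset_convexHull ℝ _ hx) ?_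
    exact Integrable.of_bound measurable_id.aestronglyMeasurable ‖G‖
      (hc.mono fun x hx => hbound _ (hG _ (subset_convexHull ℝ _ hx)))
  · have := Measure.integral_compProd hsnd
    rw [← this, hκ, integral_map hpair.aemeasurable measurable_snd.aestronglyMeasurable]

end Region

end DcC

/-! ### Stability of maximizers, feasible rates and the unique optimum -/

namespace DcC

/-- Near-maximizers close to a compact set on which the maximizer is unique are close to it. -/
theorem exists_near_maximizer_dist_le {E : Type*} [PseudoMetricSpace E] {K F : Set E}
    (hK : IsCompact K) (hF : IsCompact F) (hFK : F ⊆ K) {φ : E → ℝ} (hφ : ContinuousOn φ K) {y : E}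
    (hy : ∀ z ∈ F, φ y ≤ φ z → dist z y = 0) {ε : ℝ} (hε : 0 < ε) :
    ∃ δ > 0, ∀ a ∈ K, ∀ b ∈ F, dist a b ≤ δ → φ y - δ ≤ φ a → dist a y ≤ ε := by
  set S : Set (E × E) := {p ∈ K ×ˢ F | ε ≤ dist p.1 y} with hS
  have hSc : IsCompact S := by
    refine (hK.prod hF).inter_right ?_
    exact isClosed_le continuous_const (continuous_fst.dist continuous_const)
  -- The three terms are the distance to feasibility and the utility deficits of the two points. On
  -- `S` they are never all nonpositive: otherwise the feasible point would be at distance `0` from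
  -- `y`, and the other one too. By compactness their maximum has a positive lower bound `m`.
  have hψ : ContinuousOn (fun p : E × E => max (max (dist p.1 p.2) (φ y - φ p.1))
      (φ y - φ p.2)) S := by
    have h1 : ContinuousOn (fun p : E × E => φ p.1) S :=
      hφ.comp continuousOn_fst fun p hp => hp.1.1
    have h2 : ContinuousOn (fun p : E × E => φ p.2) S :=
      hφ.comp continuousOn_snd fun p hp => hFK hp.1.2
    exact ((continuous_dist.continuousOn.sup (continuousOn_const.sub h1))).sup
      (continuousOn_const.sub h2)
  have hpos : ∀ p ∈ S, 0 < max (max (dist p.1 p.2) (φ y - φ p.1)) (φ y - φ p.2) := by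
    rintro p ⟨⟨-, hp2⟩, hpε⟩
    by_contra! h
    obtain ⟨h12, h3⟩ := max_le_iff.1 h
    obtain ⟨h1, -⟩ := max_le_iff.1 h12
    have := hy p.2 hp2 (by linarith)
    linarith [dist_triangle p.1 p.2 y]
  have hmin : ∃ m > 0, ∀ p ∈ S, m ≤ max (max (dist p.1 p.2) (φ y - φ p.1)) (φ y - φ p.2) := by
    rcases S.eq_empty_or_nonempty with h | h
    · exact ⟨1, one_pos, by simp [h]⟩
    · obtain ⟨p, hp, hpm⟩ := hSc.exists_isMinOn h hψ
      exact ⟨_, hpos p hp, fun q hq => hpm hq⟩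
  obtain ⟨m, hm, hmS⟩ := hmin
  have hu : UniformContinuousOn φ K := hK.uniformContinuousOn_of_continuous hφ
  obtain ⟨η, hη, hηK⟩ := Metric.uniformContinuousOn_iff.1 hu (m / 2) (by positivity)
  -- The deficit of `b` is at most that of `a`, up to `m / 4`, plus `m / 2` from uniform continuity;
  -- so all three terms stay below `m`.
  refine ⟨min (m / 4) (η / 2), by positivity, fun a ha b hb hab hφa => ?_⟩
  by_contra! hlt
  have h1 := hmS (a, b) ⟨⟨ha, hb⟩, hlt.le⟩
  have h2 : min (m / 4) (η / 2) ≤ m / 4 := min_le_left _ _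
  have h3 : min (m / 4) (η / 2) ≤ η / 2 := min_le_right _ _
  have h4 := hηK a ha b (hFK hb) (by linarith)
  rw [Real.dist_eq] at h4
  have h5 := le_abs_self (φ a - φ b)
  simp only [le_max_iff] at h1
  rcases h1 with (h1 | h1) | h1 <;> linarith

/-- While the queue does not empty, expanding `(q - o + y)²` leaves `-2oy`, which is dropped. If it
empties, `q'² ≤ y²`, and the other terms are `(q - o)² + 2qy ≥ 0`. -/
theorem max_sub_add_sq_le {q o y q' : ℝ} (hq : 0 ≤ q) (ho : 0 ≤ o) (hy : 0 ≤ y) (hq' : 0 ≤ q')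
    (h : q' ≤ max (q - o) 0 + y) : q' ^ 2 ≤ q ^ 2 + o ^ 2 + y ^ 2 + 2 * (q * y) - 2 * (q * o) := by
  have h1 : q' ^ 2 ≤ (max (q - o) 0 + y) ^ 2 := by gcongr
  rcases le_total (q - o) 0 with h2 | h2
  · rw [max_eq_right h2] at h1
    nlinarith [mul_nonneg hq hy, sq_nonneg (q - o)]
  · rw [max_eq_left h2] at h1
    nlinarith [mul_nonneg ho hy]

variable {N : Type*} [Fintype N] [DecidableEq N]

theorem sum_uLink (F : N → N → ℝ) :
    ∑ e : ULink N, F e.1.1 e.1.2 = ∑ k, ∑ n ∈ univ.erase k, F k n := by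
  have h1 : ∑ e : ULink N, F e.1.1 e.1.2 = ∑ p : N × N with p.1 ≠ p.2, F p.1 p.2 :=
    (Finset.sum_subtype (p := fun p : N × N => p.1 ≠ p.2) _ (by simp)
      (fun p : N × N => F p.1 p.2)).symm
  rw [h1, Finset.sum_filter, Fintype.sum_prod_type]
  refine Finset.sum_congr rfl fun k _ => ?_
  rw [← Finset.sum_filter]
  congr 1
  ext n
  simp [eq_comm]

theorem sum_uLink_swap (F : N → N → ℝ) :
    ∑ e : ULink N, F e.1.2 e.1.1 = ∑ k, ∑ n ∈ univ.erase k, F k n := by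
  rw [sum_uLink fun k n => F n k]
  refine Finset.sum_comm' fun k n => ?_
  simp [eq_comm]

/-- The rate vectors that are compatible with the average cellular rates `Rc` and the average local
rates `L`. -/
def feasibleRates (Rc : Set (N → ℝ)) (L : Set (ULink N → ℝ)) : Set (N → ℝ) :=
  {y | ∃ (gs : N → N → ℝ), ∃ r ∈ Rc, (∀ k n, 0 ≤ gs k n ∧ gs k n ≤ r k) ∧
    (fun e : ULink N => gs e.1.2 e.1.1) ∈ L ∧ y = fun k => ∑ n, gs n k}

omit [DecidableEq N] in
theorem convex_feasibleRates {Rc : Set (N → ℝ)} {L : Set (ULink N → ℝ)} (hRc : Convex ℝ Rc)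
    (hL : Convex ℝ L) : Convex ℝ (feasibleRates Rc L) := by
  rintro _ ⟨g, r, hr, hgr, hgL, rfl⟩ _ ⟨g', r', hr', hgr', hgL', rfl⟩ a b ha hb hab
  refine ⟨fun k n => a * g k n + b * g' k n, _, hRc hr hr' ha hb hab, fun k n => ⟨?_, ?_⟩,
    hL hgL hgL' ha hb hab, ?_⟩
  · have h1 := (hgr k n).1
    have h2 := (hgr' k n).1
    positivity
  · have h1 := (hgr k n).2
    have h2 := (hgr' k n).2
    simp only [Pi.add_apply, Pi.smul_apply, smul_eq_mul]
    gcongr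
  · ext k
    simp [Finset.sum_add_distrib, Finset.mul_sum]

omit [DecidableEq N] in
-- The witnesses `(gs, r)` form a closed set, bounded because `0 ≤ gs ≤ r`, and the rates depend on
-- them continuously.
theorem isCompact_feasibleRates {Rc : Set (N → ℝ)} {L : Set (ULink N → ℝ)} (hRc : IsCompact Rc)
    (hL : IsClosed L) : IsCompact (feasibleRates Rc L) := by
  obtain ⟨G, hG⟩ := hRc.isBounded.exists_norm_le
  set Z : Set ((N → N → ℝ) × (N → ℝ)) := {p | p.2 ∈ Rc ∧ (∀ k n, 0 ≤ p.1 k n ∧ p.1 k n ≤ p.2 k) ∧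
    (fun e : ULink N => p.1 e.1.2 e.1.1) ∈ L} with hZ
  have hZc : IsClosed Z := by
    have h1 : IsClosed {p : (N → N → ℝ) × (N → ℝ) | p.2 ∈ Rc} :=
      hRc.isClosed.preimage continuous_snd
    have h2 : ∀ k n, IsClosed {p : (N → N → ℝ) × (N → ℝ) | 0 ≤ p.1 k n} := fun k n =>
      isClosed_le continuous_const (by fun_prop)
    have h3 : ∀ k n, IsClosed {p : (N → N → ℝ) × (N → ℝ) | p.1 k n ≤ p.2 k} := fun k n =>
      isClosed_le (by fun_prop) (by fun_prop)
    have h4 : IsClosed {p : (N → N → ℝ) × (N → ℝ) | (fun e : ULink N => p.1 e.1.2 e.1.1) ∈ L} :=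
      hL.preimage (by fun_prop)
    convert h1.inter ((isClosed_iInter fun k => isClosed_iInter fun n =>
      (h2 k n).inter (h3 k n)).inter h4) using 1
    ext p
    simp [hZ]
  have hZk : IsCompact Z := by
    refine (((isCompact_univ_pi fun k => isCompact_univ_pi fun _ : N =>
      isCompact_Icc (a := (0 : ℝ)) (b := G)).prod hRc)).of_isClosed_subset hZc ?_
    rintro p ⟨h1, h2, -⟩
    exact ⟨fun k _ n _ => ⟨(h2 k n).1, ((h2 k n).2.trans (le_abs_self _)).trans
      ((norm_le_pi_norm p.2 k).trans (hG _ h1))⟩, h1⟩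
  have himg : feasibleRates Rc L = (fun p : (N → N → ℝ) × (N → ℝ) => fun k => ∑ n, p.1 n k) '' Z := by
    ext y
    constructor
    · rintro ⟨g, r, hr, h1, h2, rfl⟩
      exact ⟨(g, r), ⟨hr, h1, h2⟩, rfl⟩
    · rintro ⟨p, ⟨hr, h1, h2⟩, rfl⟩
      exact ⟨p.1, p.2, hr, h1, h2, rfl⟩
  rw [himg]
  exact hZk.image (by fun_prop)

omit [DecidableEq N] in
-- Each cellular link carries for one device at most its whole rate. Thus the condition on `Rmax`
-- makes every feasible vector an admissible competitor for the rate controller.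
theorem feasibleRates_le {Rc : Set (N → ℝ)} {L : Set (ULink N → ℝ)} {Rmax : N → ℝ}
    (hR : ∀ k, ∀ r ∈ Rc, ∑ n, r n ≤ Rmax k) : feasibleRates Rc L ⊆ Set.Icc 0 Rmax := by
  rintro _ ⟨g, r, hr, h1, -, rfl⟩
  exact ⟨fun k => Finset.sum_nonneg fun n _ => (h1 n k).1,
    fun k => (Finset.sum_le_sum fun n _ => (h1 n k).2).trans (hR k r hr)⟩

omit [DecidableEq N] in
theorem strictConcaveOn_sum {U : N → ℝ → ℝ} (hU : ∀ k, StrictConcaveOn ℝ (Set.Ici 0) (U k)) :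
    StrictConcaveOn ℝ (Set.Ici (0 : N → ℝ)) fun y => ∑ k, U k (y k) := by
  refine ⟨convex_Ici 0, fun x hx y hy hxy a b ha hb hab => ?_⟩
  obtain ⟨i, hi⟩ := Function.ne_iff.1 hxy
  simp only [smul_eq_mul, Finset.mul_sum, ← Finset.sum_add_distrib]
  refine Finset.sum_lt_sum (fun k _ => ?_) ⟨i, mem_univ i, ?_⟩
  · exact (hU k).concaveOn.2 (hx k) (hy k) ha.le hb.le hab
  · exact (hU i).2 (hx i) (hy i) hi ha hb hab

omit [DecidableEq N] in
/-- Existence and uniqueness of the optimum. -/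
theorem exists_unique_optimum {U : N → ℝ → ℝ} (hU : ∀ k, StrictConcaveOn ℝ (Set.Ici 0) (U k))
    (hUc : ∀ k, ContinuousOn (U k) (Set.Ici 0)) {F : Set (N → ℝ)} (hF : IsCompact F)
    (hconv : Convex ℝ F) (hne : F.Nonempty) (hF0 : F ⊆ Set.Ici 0) :
    ∃ y ∈ F, (∀ z ∈ F, ∑ k, U k (z k) ≤ ∑ k, U k (y k)) ∧
      ∀ z ∈ F, ∑ k, U k (y k) ≤ ∑ k, U k (z k) → z = y := by
  have hc : ContinuousOn (fun y : N → ℝ => ∑ k, U k (y k)) F :=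
    continuousOn_finsetSum _ fun k _ =>
      (hUc k).comp (continuous_apply k).continuousOn fun y hy => hF0 hy k
  obtain ⟨y, hy, hmax⟩ := hF.exists_isMaxOn hne hc
  refine ⟨y, hy, fun z hz => hmax hz, fun z hz hle => ?_⟩
  have hzmax : IsMaxOn (fun y : N → ℝ => ∑ k, U k (y k)) F z := fun x hx => (hmax hx).trans hle
  exact ((strictConcaveOn_sum hU).subset hF0 hconv).eq_of_isMaxOn hzmax hmax hz hy

end DcC

/-! ### Energy of the queues and its expected drift -/

namespace DcC

variable {N S W : Type*} [Fintype N] [DecidableEq N]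

theorem sum_cellObjective (lam : N → ℝ) (eta Q : N → N → ℝ) (g : N → N → ℝ) :
    ∑ k, cellObjective lam eta Q k (g k) =
      ∑ k, lam k * g k k + ∑ e : ULink N, (eta e.1.2 e.1.1 - Q e.1.2 e.1.1) * g e.1.2 e.1.1 := by
  rw [sum_uLink_swap fun k n => (eta k n - Q k n) * g k n, ← Finset.sum_add_distrib]
  rfl

/-- When the relayed traffic is conserved, the objectives add up to the weight of the total rates. -/
theorem sum_cellObjective_add_uniObjective (lam : N → ℝ) (eta Q : N → N → ℝ) (g : N → N → ℝ) :
    ∑ k, cellObjective lam eta Q k (g k) +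
      uniObjective lam eta Q (fun e : ULink N => g e.1.2 e.1.1) = ∑ k, lam k * ∑ n, g n k := by
  have h : ∀ k, lam k * ∑ n, g n k = lam k * g k k + ∑ n ∈ univ.erase k, lam k * g n k := by
    intro k
    rw [← Finset.add_sum_erase _ _ (mem_univ k), mul_add, Finset.mul_sum]
  rw [sum_cellObjective, Finset.sum_congr rfl fun k _ => h k, Finset.sum_add_distrib,
    ← sum_uLink fun k n => lam k * g n k, add_assoc, uniObjective, ← Finset.sum_add_distrib]
  congr 1
  refine Finset.sum_congr rfl fun e _ => ?_
  ring

theorem sum_mul_offered (lam : N → ℝ) (gs gl : N → N → ℝ) :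
    ∑ k, lam k * offered gs gl k =
      ∑ k, lam k * gs k k + ∑ e : ULink N, lam e.1.1 * gl e.1.1 e.1.2 := by
  rw [sum_uLink fun k n => lam k * gl k n, ← Finset.sum_add_distrib]
  refine Finset.sum_congr rfl fun k _ => ?_
  rw [offered, mul_add, Finset.mul_sum]

/-- The sum of the squares of all queues. -/
def lyapunov (lam : N → ℝ) (eta Q : N → N → ℝ) : ℝ :=
  ∑ k, lam k ^ 2 + ∑ e : ULink N, (eta e.1.2 e.1.1 ^ 2 + Q e.1.2 e.1.1 ^ 2)

theorem lyapunov_nonneg (lam : N → ℝ) (eta Q : N → N → ℝ) : 0 ≤ lyapunov lam eta Q := by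
  unfold lyapunov
  positivity

theorem lam_sq_le_lyapunov (lam : N → ℝ) (eta Q : N → N → ℝ) (k : N) :
    lam k ^ 2 ≤ lyapunov lam eta Q := by
  have h1 := Finset.single_le_sum (f := fun k => lam k ^ 2) (fun i _ => sq_nonneg _) (mem_univ k)
  have h2 : 0 ≤ ∑ e : ULink N, (eta e.1.2 e.1.1 ^ 2 + Q e.1.2 e.1.1 ^ 2) := by positivity
  unfold lyapunov
  linarith

theorem eta_sq_le_lyapunov (lam : N → ℝ) (eta Q : N → N → ℝ) {n k : N} (h : n ≠ k) :
    eta n k ^ 2 ≤ lyapunov lam eta Q := by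
  have h1 := Finset.single_le_sum
    (f := fun e : ULink N => eta e.1.2 e.1.1 ^ 2 + Q e.1.2 e.1.1 ^ 2)
    (fun i _ => by positivity) (mem_univ (⟨(k, n), h.symm⟩ : ULink N))
  have h2 : 0 ≤ ∑ k, lam k ^ 2 := by positivity
  simp only at h1
  unfold lyapunov
  nlinarith [sq_nonneg (Q n k)]

/-- A bound of the second order terms of the drift, for rates up to `G`. -/
noncomputable def driftBound (N : Type*) [Fintype N] (G : ℝ) : ℝ :=
  Fintype.card N * (((1 + Fintype.card N) * G) ^ 2 + G ^ 2) +
    Nat.card (ULink N) * (4 * G ^ 2)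

section BoundedRun

variable {Ω : Type*} [mΩ : MeasurableSpace Ω] [MeasurableSpace S] [MeasurableSpace W]

/-- A run with rate control in which all rates are at most `G`. -/
structure BoundedRun (net : Network N S W) (M : ℝ) (P : Measure Ω) (ℱ : Filtration ℕ mΩ)
    (C : ℕ → Ω → (N → S) × (ULink N → W)) (G : ℝ) (R : Run N Ω) : Prop where
  causal : Causal P ℱ C R
  dynamics : QueueDynamics net R
  rate : RateControl net M R
  beta_nonneg : 0 ≤ net.β
  rate_le : ∀ k, net.Rmax k ≤ G
  gs_mem : ∀ t ω k n, R.gs t ω k n ∈ Set.Icc 0 G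
  gl_mem : ∀ t ω k n, k ≠ n → R.gl t ω k n ∈ Set.Icc 0 G

variable {net : Network N S W} {M : ℝ} {P : Measure Ω} {ℱ : Filtration ℕ mΩ}
  {C : ℕ → Ω → (N → S) × (ULink N → W)} {G : ℝ} {R : Run N Ω}

namespace BoundedRun

theorem y_mem (h : BoundedRun net M P ℱ C G R) (t : ℕ) (ω : Ω) (k : N) :
    R.y t ω k ∈ Set.Icc 0 G :=
  ⟨(h.rate t ω k).1.1, (h.rate t ω k).1.2.trans (h.rate_le k)⟩

theorem offered_mem (h : BoundedRun net M P ℱ C G R) (t : ℕ) (ω : Ω) (k : N) :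
    offered (R.gs t ω) (R.gl t ω) k ∈ Set.Icc 0 ((1 + Fintype.card N) * G) := by
  have hG : 0 ≤ G := (h.gs_mem t ω k k).1.trans (h.gs_mem t ω k k).2
  have h1 : ∀ n ∈ univ.erase k, R.gl t ω k n ∈ Set.Icc 0 G := fun n hn =>
    h.gl_mem t ω k n (Finset.ne_of_mem_erase hn).symm
  refine ⟨add_nonneg (h.gs_mem t ω k k).1 (Finset.sum_nonneg fun n hn => (h1 n hn).1), ?_⟩
  have h2 : ∑ n ∈ univ.erase k, R.gl t ω k n ≤ Fintype.card N * G := by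
    calc ∑ n ∈ univ.erase k, R.gl t ω k n ≤ ∑ n ∈ univ.erase k, G :=
          Finset.sum_le_sum fun n hn => (h1 n hn).2
      _ = ((univ.erase k).card : ℝ) * G := by simp
      _ ≤ Fintype.card N * G := by
          gcongr
          exact Finset.card_le_univ _
  have h3 := (h.gs_mem t ω k k).2
  unfold offered
  linarith

/-- One-step bound of the Lyapunov function. -/
theorem lyapunov_succ_le (h : BoundedRun net M P ℱ C G R) (t : ℕ) (ω : Ω) :
    lyapunov (R.lam (t + 1) ω) (R.eta (t + 1) ω) (R.Q (t + 1) ω) ≤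
      lyapunov (R.lam t ω) (R.eta t ω) (R.Q t ω) + driftBound N G +
        2 * (∑ k, R.lam t ω k * R.y t ω k -
          ∑ k, cellObjective (R.lam t ω) (R.eta t ω) (R.Q t ω) k (R.gs t ω k) -
          uniObjective (R.lam t ω) (R.eta t ω) (R.Q t ω)
            fun e : ULink N => R.gl t ω e.1.1 e.1.2) := by
  have hd := h.dynamics
  have hl : ∑ k, R.lam (t + 1) ω k ^ 2 ≤ ∑ k, (R.lam t ω k ^ 2 +
      (((1 + Fintype.card N) * G) ^ 2 + G ^ 2) + 2 * (R.lam t ω k * R.y t ω k) -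
      2 * (R.lam t ω k * offered (R.gs t ω) (R.gl t ω) k)) := by
    refine Finset.sum_le_sum fun k _ => ?_
    have ho := h.offered_mem t ω k
    have hy := h.y_mem t ω k
    have h1 := max_sub_add_sq_le (hd.lam_nonneg t ω k) ho.1 hy.1 (hd.lam_nonneg (t + 1) ω k)
      (hd.lam_succ t ω k).le
    have h2 := pow_le_pow_left₀ ho.1 ho.2 2
    have h3 := pow_le_pow_left₀ hy.1 hy.2 2
    linarith
  -- Arrivals and services of `η` are those of `Q` interchanged, so the cross terms carry the weight
  -- `η - Q`, and each of the two queues contributes `2G²`. Subtracting `β` only lowers the arrivals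
  -- at `Q`.
  have he : ∑ e : ULink N, (R.eta (t + 1) ω e.1.2 e.1.1 ^ 2 + R.Q (t + 1) ω e.1.2 e.1.1 ^ 2) ≤
      ∑ e : ULink N, ((R.eta t ω e.1.2 e.1.1 ^ 2 + R.Q t ω e.1.2 e.1.1 ^ 2) + 4 * G ^ 2 +
        2 * ((R.eta t ω e.1.2 e.1.1 - R.Q t ω e.1.2 e.1.1) * R.gl t ω e.1.1 e.1.2) -
        2 * ((R.eta t ω e.1.2 e.1.1 - R.Q t ω e.1.2 e.1.1) * R.gs t ω e.1.2 e.1.1)) := by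
    refine Finset.sum_le_sum fun e _ => ?_
    obtain ⟨⟨k, n⟩, hkn⟩ := e
    have hnk : n ≠ k := Ne.symm hkn
    have hgs := h.gs_mem t ω n k
    have hgl := h.gl_mem t ω k n hkn
    have h1 := max_sub_add_sq_le (hd.eta_nonneg t ω n k hnk) hgs.1 hgl.1
      (hd.eta_nonneg (t + 1) ω n k hnk) (hd.eta_succ_le t ω n k hnk)
    have hQ : R.Q (t + 1) ω n k ≤ max (R.Q t ω n k - R.gl t ω k n) 0 + R.gs t ω n k := by
      refine (hd.Q_succ_le t ω n k hnk).trans ?_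
      gcongr
      exact max_le (by linarith [h.beta_nonneg]) hgs.1
    have h2 := max_sub_add_sq_le (hd.Q_nonneg t ω n k hnk) hgl.1 hgs.1
      (hd.Q_nonneg (t + 1) ω n k hnk) hQ
    have h3 := pow_le_pow_left₀ hgs.1 hgs.2 2
    have h4 := pow_le_pow_left₀ hgl.1 hgl.2 2
    simp only
    nlinarith
  simp only [Finset.sum_sub_distrib, Finset.sum_add_distrib, ← Finset.mul_sum, Finset.sum_const,
    Finset.card_univ, nsmul_eq_mul] at hl he
  rw [sum_mul_offered] at hl
  have hu : uniObjective (R.lam t ω) (R.eta t ω) (R.Q t ω)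
      (fun e : ULink N => R.gl t ω e.1.1 e.1.2) =
      ∑ e : ULink N, R.lam t ω e.1.1 * R.gl t ω e.1.1 e.1.2 -
      ∑ e : ULink N, (R.eta t ω e.1.2 e.1.1 - R.Q t ω e.1.2 e.1.1) * R.gl t ω e.1.1 e.1.2 := by
    rw [← Finset.sum_sub_distrib]
    exact Finset.sum_congr rfl fun e _ => by ring
  rw [sum_cellObjective, hu, driftBound, lyapunov, lyapunov, Nat.card_eq_fintype_card]
  simp only [Finset.sum_add_distrib]
  linarith

theorem measurable_lam (h : BoundedRun net M P ℱ C G R) (t : ℕ) (k : N) :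
    Measurable fun ω => R.lam t ω k :=
  (measurable_pi_apply k).comp ((h.causal.lam_meas t).mono (ℱ.le t) le_rfl)

theorem measurable_eta (h : BoundedRun net M P ℱ C G R) (t : ℕ) (n k : N) :
    Measurable fun ω => R.eta t ω n k :=
  (measurable_pi_apply k).comp
    ((measurable_pi_apply n).comp ((h.causal.eta_meas t).mono (ℱ.le t) le_rfl))

theorem measurable_Q (h : BoundedRun net M P ℱ C G R) (t : ℕ) (n k : N) :
    Measurable fun ω => R.Q t ω n k :=
  (measurable_pi_apply k).comp
    ((measurable_pi_apply n).comp ((h.causal.Q_meas t).mono (ℱ.le t) le_rfl))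

theorem measurable_y (h : BoundedRun net M P ℱ C G R) (t : ℕ) (k : N) :
    Measurable fun ω => R.y t ω k :=
  (measurable_pi_apply k).comp (h.causal.y_meas t)

theorem measurable_gs (h : BoundedRun net M P ℱ C G R) (t : ℕ) (k n : N) :
    Measurable fun ω => R.gs t ω k n :=
  (measurable_pi_apply n).comp ((measurable_pi_apply k).comp (h.causal.gs_meas t))

theorem measurable_gl (h : BoundedRun net M P ℱ C G R) (t : ℕ) (k n : N) :
    Measurable fun ω => R.gl t ω k n :=
  (measurable_pi_apply n).comp ((measurable_pi_apply k).comp (h.causal.gl_meas t))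

theorem measurable_a (h : BoundedRun net M P ℱ C G R) (t : ℕ) (k n : N) :
    Measurable fun ω => R.a t ω k n :=
  (measurable_pi_apply n).comp ((measurable_pi_apply k).comp (h.causal.a_meas t))

variable [IsProbabilityMeasure P]

theorem _root_.DcC.memLp_of_le_add_const {q q' : Ω → ℝ} {c : ℝ} (hq : MemLp q 2 P)
    (hm : Measurable q') (h0 : ∀ ω, 0 ≤ q' ω) (hle : ∀ ω, q' ω ≤ q ω + c) : MemLp q' 2 P :=
  (hq.add (memLp_const c)).mono' hm.aestronglyMeasurable
    (Eventually.of_forall fun ω => by rw [Real.norm_of_nonneg (h0 ω)]; exact hle ω)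

/-- A queue grows by at most `G` per slot, so square integrability propagates from the initial
values. -/
theorem memLp_lam (h : BoundedRun net M P ℱ C G R) (t : ℕ) (k : N) :
    MemLp (fun ω => R.lam t ω k) 2 P := by
  induction t with
  | zero => exact h.causal.lam_init k
  | succ t ih =>
    refine memLp_of_le_add_const (c := G) ih (h.measurable_lam _ k)
      (fun ω => h.dynamics.lam_nonneg _ ω k) fun ω => ?_
    rw [h.dynamics.lam_succ]
    gcongr
    · exact max_le (sub_le_self _ (h.offered_mem t ω k).1) (h.dynamics.lam_nonneg t ω k)
    · exact (h.y_mem t ω k).2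

theorem memLp_eta (h : BoundedRun net M P ℱ C G R) (t : ℕ) {n k : N} (hnk : n ≠ k) :
    MemLp (fun ω => R.eta t ω n k) 2 P := by
  induction t with
  | zero => exact h.causal.eta_init n k hnk
  | succ t ih =>
    refine memLp_of_le_add_const (c := G) ih (h.measurable_eta _ n k)
      (fun ω => h.dynamics.eta_nonneg _ ω n k hnk) fun ω => ?_
    refine (h.dynamics.eta_succ_le t ω n k hnk).trans ?_
    gcongr
    · exact max_le (sub_le_self _ (h.gs_mem t ω n k).1) (h.dynamics.eta_nonneg t ω n k hnk)
    · exact (h.gl_mem t ω k n hnk.symm).2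

theorem memLp_Q (h : BoundedRun net M P ℱ C G R) (t : ℕ) {n k : N} (hnk : n ≠ k) :
    MemLp (fun ω => R.Q t ω n k) 2 P := by
  induction t with
  | zero => exact h.causal.Q_init n k hnk
  | succ t ih =>
    refine memLp_of_le_add_const (c := G) ih (h.measurable_Q _ n k)
      (fun ω => h.dynamics.Q_nonneg _ ω n k hnk) fun ω => ?_
    refine (h.dynamics.Q_succ_le t ω n k hnk).trans ?_
    have := h.gs_mem t ω n k
    gcongr
    · exact max_le (sub_le_self _ (h.gl_mem t ω k n hnk.symm).1) (h.dynamics.Q_nonneg t ω n k hnk)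
    · exact max_le (by linarith [h.beta_nonneg, this.2]) (this.1.trans this.2)

theorem _root_.DcC.integrable_of_mem_Icc {g : Ω → ℝ} {b : ℝ} (hm : Measurable g)
    (h : ∀ ω, g ω ∈ Set.Icc 0 b) : Integrable g P :=
  Integrable.of_bound hm.aestronglyMeasurable b
    (Eventually.of_forall fun ω => by rw [Real.norm_of_nonneg (h ω).1]; exact (h ω).2)

omit [IsProbabilityMeasure P] in
theorem _root_.DcC.integrable_mul_of_mem_Icc {q g : Ω → ℝ} {b : ℝ} (hq : Integrable q P)
    (hm : Measurable g) (h : ∀ ω, g ω ∈ Set.Icc 0 b) : Integrable (fun ω => q ω * g ω) P :=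
  hq.mul_bdd (c := b) hm.aestronglyMeasurable
    (Eventually.of_forall fun ω => by rw [Real.norm_of_nonneg (h ω).1]; exact (h ω).2)

theorem integrable_lam (h : BoundedRun net M P ℱ C G R) (t : ℕ) (k : N) :
    Integrable (fun ω => R.lam t ω k) P := (h.memLp_lam t k).integrable (by norm_num)

theorem integrable_eta (h : BoundedRun net M P ℱ C G R) (t : ℕ) {n k : N} (hnk : n ≠ k) :
    Integrable (fun ω => R.eta t ω n k) P := (h.memLp_eta t hnk).integrable (by norm_num)

theorem integrable_Q (h : BoundedRun net M P ℱ C G R) (t : ℕ) {n k : N} (hnk : n ≠ k) :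
    Integrable (fun ω => R.Q t ω n k) P := (h.memLp_Q t hnk).integrable (by norm_num)

theorem integrable_weight (h : BoundedRun net M P ℱ C G R) (t : ℕ) (e : ULink N) :
    Integrable (fun ω => R.lam t ω e.1.1 - R.eta t ω e.1.2 e.1.1 + R.Q t ω e.1.2 e.1.1) P :=
  ((h.integrable_lam t _).sub (h.integrable_eta t e.2.symm)).add (h.integrable_Q t e.2.symm)

/-- The objective of the cellular scheduler is integrable for bounded random rates. -/
theorem integrable_cellObjective (h : BoundedRun net M P ℱ C G R) (t : ℕ) (k : N)
    {g : Ω → N → ℝ} {b : ℝ} (hm : ∀ n, Measurable fun ω => g ω n)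
    (hg : ∀ ω n, g ω n ∈ Set.Icc 0 b) :
    Integrable (fun ω => cellObjective (R.lam t ω) (R.eta t ω) (R.Q t ω) k (g ω)) P := by
  refine (integrable_mul_of_mem_Icc (h.integrable_lam t k) (hm k) fun ω => hg ω k).add
    (integrable_finsetSum _ fun n hn => ?_)
  have hkn : k ≠ n := (Finset.ne_of_mem_erase hn).symm
  exact integrable_mul_of_mem_Icc ((h.integrable_eta t hkn).sub (h.integrable_Q t hkn)) (hm n)
    fun ω => hg ω n

theorem integrable_uniObjective (h : BoundedRun net M P ℱ C G R) (t : ℕ)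
    {g : Ω → ULink N → ℝ} {b : ℝ} (hm : ∀ e, Measurable fun ω => g ω e)
    (hg : ∀ ω e, g ω e ∈ Set.Icc 0 b) :
    Integrable (fun ω => uniObjective (R.lam t ω) (R.eta t ω) (R.Q t ω) (g ω)) P :=
  integrable_finsetSum _ fun e _ => integrable_mul_of_mem_Icc (h.integrable_weight t e) (hm e)
    fun ω => hg ω e

theorem integrable_lyapunov (h : BoundedRun net M P ℱ C G R) (t : ℕ) :
    Integrable (fun ω => lyapunov (R.lam t ω) (R.eta t ω) (R.Q t ω)) P :=
  (integrable_finsetSum _ fun k _ => (h.memLp_lam t k).integrable_sq).add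
    (integrable_finsetSum _ fun e _ => (h.memLp_eta t e.2.symm).integrable_sq.add
      (h.memLp_Q t e.2.symm).integrable_sq)

theorem integrable_utility (h : BoundedRun net M P ℱ C G R)
    (hUc : ∀ k, ContinuousOn (net.U k) (Set.Ici 0)) (t : ℕ) (k : N) :
    Integrable (fun ω => net.U k (R.y t ω k)) P := by
  -- The utility is controlled on `[0, ∞)` only; truncation yields a continuous function on the line
  -- that agrees with it at the admitted rates.
  have hc : Continuous fun v : ℝ => net.U k (max v 0) :=
    (hUc k).comp_continuous (by fun_prop) fun v => le_max_right v 0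
  have hm : Measurable fun ω => net.U k (R.y t ω k) := by
    have h1 : (fun ω => net.U k (R.y t ω k)) = (fun v => net.U k (max v 0)) ∘ fun ω => R.y t ω k := by
      ext ω
      simp [(h.y_mem t ω k).1]
    rw [h1]
    exact hc.measurable.comp (h.measurable_y t k)
  obtain ⟨b, hb⟩ := (isCompact_Icc (a := (0 : ℝ)) (b := G)).exists_bound_of_continuousOn
    ((hUc k).mono fun v hv => hv.1)
  exact Integrable.of_bound hm.aestronglyMeasurable b
    (Eventually.of_forall fun ω => hb _ (h.y_mem t ω k))

end BoundedRun

/-- A run whose schedulers are, in expectation, at least as good as any stationary schedule. -/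
structure OptimalRun (net : Network N S W) (M : ℝ) (P : Measure Ω) (ℱ : Filtration ℕ mΩ)
    (C : ℕ → Ω → (N → S) × (ULink N → W)) (G : ℝ) (Rc : Set (N → ℝ)) (L : Set (ULink N → ℝ))
    (R : Run N Ω) : Prop extends BoundedRun net M P ℱ C G R where
  cell_opt : ∀ t, ∀ g : N → N → ℝ, ∀ r ∈ Rc, (∀ k n, 0 ≤ g k n ∧ g k n ≤ r k) →
    ∫ ω, ∑ k, cellObjective (R.lam t ω) (R.eta t ω) (R.Q t ω) k (g k) ∂P ≤
      ∫ ω, ∑ k, cellObjective (R.lam t ω) (R.eta t ω) (R.Q t ω) k (R.gs t ω k) ∂P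
  local_opt : ∀ t, ∀ v ∈ L, ∫ ω, uniObjective (R.lam t ω) (R.eta t ω) (R.Q t ω) v ∂P ≤
    ∫ ω, uniObjective (R.lam t ω) (R.eta t ω) (R.Q t ω)
      (fun e : ULink N => R.gl t ω e.1.1 e.1.2) ∂P
  cell_mem : ∀ t, ∃ r ∈ Rc, ∀ k n, ∫ ω, R.gs t ω k n ∂P ≤ r k
  local_mem : ∀ t, (fun e : ULink N => ∫ ω, R.gl t ω e.1.1 e.1.2 ∂P) ∈ L

namespace OptimalRun

variable {Rc : Set (N → ℝ)} {L : Set (ULink N → ℝ)} [IsProbabilityMeasure P]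

theorem _root_.DcC.integral_le_of_drift {f' f u p p' q q' : Ω → ℝ} {B c b : ℝ}
    (hf' : Integrable f' P) (hf : Integrable f P) (hu : Integrable u P) (hp : Integrable p P)
    (hp' : Integrable p' P) (hq : Integrable q P) (hq' : Integrable q' P)
    (h : ∀ ω, f' ω ≤ f ω + B + c * (u ω - b) + 2 * ((p ω - p' ω) + (q ω - q' ω)))
    (hpp : ∫ ω, p ω ∂P ≤ ∫ ω, p' ω ∂P) (hqq : ∫ ω, q ω ∂P ≤ ∫ ω, q' ω ∂P) :
    ∫ ω, f' ω ∂P ≤ ∫ ω, f ω ∂P + B + c * (∫ ω, u ω ∂P - b) := by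
  have i1 : Integrable (fun ω => f ω + B) P := hf.add (integrable_const _)
  have i2 : Integrable (fun ω => u ω - b) P := hu.sub (integrable_const _)
  have i3 : Integrable (fun ω => f ω + B + c * (u ω - b)) P := i1.add (i2.const_mul c)
  have i4 : Integrable (fun ω => p ω - p' ω) P := hp.sub hp'
  have i5 : Integrable (fun ω => q ω - q' ω) P := hq.sub hq'
  have i6 : Integrable (fun ω => (p ω - p' ω) + (q ω - q' ω)) P := i4.add i5
  have hint := integral_mono hf' (i3.add (i6.const_mul 2)) h
  have h1 := integral_add i3 (i6.const_mul 2)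
  simp only [Pi.add_apply] at hint
  rw [h1, integral_add i1 (i2.const_mul c), integral_add hf (integrable_const _),
    integral_const_mul, integral_const_mul, integral_add i4 i5, integral_sub hu (integrable_const _),
    integral_sub hp hp', integral_sub hq hq'] at hint
  simp only [integral_const, probReal_univ, one_smul] at hint
  linarith

/-- The expected drift-plus-penalty bound. -/
theorem integral_lyapunov_succ_le (h : OptimalRun net M P ℱ C G Rc L R)
    (hUc : ∀ k, ContinuousOn (net.U k) (Set.Ici 0)) (hR : ∀ k, ∀ r ∈ Rc, ∑ n, r n ≤ net.Rmax k)
    {z : N → ℝ} (hz : z ∈ feasibleRates Rc L) (t : ℕ) :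
    ∫ ω, lyapunov (R.lam (t + 1) ω) (R.eta (t + 1) ω) (R.Q (t + 1) ω) ∂P ≤
      ∫ ω, lyapunov (R.lam t ω) (R.eta t ω) (R.Q t ω) ∂P + driftBound N G +
        2 * M * (∑ k, ∫ ω, net.U k (R.y t ω k) ∂P - ∑ k, net.U k (z k)) := by
  have hzR := feasibleRates_le hR hz
  obtain ⟨g, r, hr, hgr, hgL, rfl⟩ := hz
  set v : ULink N → ℝ := fun e => g e.1.2 e.1.1
  have hpt : ∀ ω, lyapunov (R.lam (t + 1) ω) (R.eta (t + 1) ω) (R.Q (t + 1) ω) ≤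
      lyapunov (R.lam t ω) (R.eta t ω) (R.Q t ω) + driftBound N G +
        2 * M * (∑ k, net.U k (R.y t ω k) - ∑ k, net.U k (∑ n, g n k)) +
        2 * ((∑ k, cellObjective (R.lam t ω) (R.eta t ω) (R.Q t ω) k (g k) -
          ∑ k, cellObjective (R.lam t ω) (R.eta t ω) (R.Q t ω) k (R.gs t ω k)) +
        (uniObjective (R.lam t ω) (R.eta t ω) (R.Q t ω) v -
          uniObjective (R.lam t ω) (R.eta t ω) (R.Q t ω)
            fun e : ULink N => R.gl t ω e.1.1 e.1.2)) := by
    intro ω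
    have h1 := h.lyapunov_succ_le t ω
    -- The competing schedule contributes exactly `∑ λ_k z_k`, which cancels the same term in the
    -- rate controller's inequality.
    have h2 := sum_cellObjective_add_uniObjective (R.lam t ω) (R.eta t ω) (R.Q t ω) g
    have h3 : ∑ k, R.lam t ω k * R.y t ω k ≤ ∑ k, (M * (net.U k (R.y t ω k) -
        net.U k (∑ n, g n k)) + R.lam t ω k * ∑ n, g n k) := by
      refine Finset.sum_le_sum fun k _ => ?_
      have := isMaxOn_iff.1 (h.rate t ω k).2 (∑ n, g n k) ⟨hzR.1 k, hzR.2 k⟩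
      linarith
    rw [Finset.sum_add_distrib, ← Finset.mul_sum, Finset.sum_sub_distrib] at h3
    linarith
  have hgb : ∀ k n, g k n ∈ Set.Icc 0 (∑ k, ∑ n, g k n) := fun k n => ⟨(hgr k n).1,
    (Finset.single_le_sum (f := fun n => g k n) (fun i _ => (hgr k i).1) (mem_univ n)).trans
      (Finset.single_le_sum (f := fun k => ∑ n, g k n)
        (fun i _ => Finset.sum_nonneg fun j _ => (hgr i j).1) (mem_univ k))⟩
  have i1 := h.integrable_lyapunov t
  have i2 : Integrable (fun ω => ∑ k, net.U k (R.y t ω k)) P :=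
    integrable_finsetSum _ fun k _ => h.integrable_utility hUc t k
  have i3 : Integrable (fun ω => ∑ k, cellObjective (R.lam t ω) (R.eta t ω) (R.Q t ω) k (g k)) P :=
    integrable_finsetSum _ fun k _ => h.integrable_cellObjective t k
      (fun n => measurable_const) fun _ n => hgb k n
  have i4 : Integrable (fun ω => ∑ k, cellObjective (R.lam t ω) (R.eta t ω) (R.Q t ω) k
      (R.gs t ω k)) P :=
    integrable_finsetSum _ fun k _ => h.integrable_cellObjective t k
      (fun n => h.measurable_gs t k n) fun ω n => h.gs_mem t ω k n
  have i5 : Integrable (fun ω => uniObjective (R.lam t ω) (R.eta t ω) (R.Q t ω) v) P :=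
    h.integrable_uniObjective t (fun _ => measurable_const) fun _ e => hgb e.1.2 e.1.1
  have i6 : Integrable (fun ω => uniObjective (R.lam t ω) (R.eta t ω) (R.Q t ω)
      fun e : ULink N => R.gl t ω e.1.1 e.1.2) P :=
    h.integrable_uniObjective t (fun e => h.measurable_gl t _ _) fun ω e => h.gl_mem t ω _ _ e.2
  have hint := integral_le_of_drift (h.integrable_lyapunov (t + 1)) i1 i2 i3 i4 i5 i6 hpt
    (h.cell_opt t g r hr hgr) (h.local_opt t v hgL)
  rwa [integral_finsetSum _ fun k _ => h.integrable_utility hUc t k] at hint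

end OptimalRun

end BoundedRun

end DcC

/-! ### From the drift to long-run averages -/

namespace DcC

variable {N S W : Type*} [Fintype N] [DecidableEq N]
  {Ω : Type*} [mΩ : MeasurableSpace Ω] [MeasurableSpace S] [MeasurableSpace W]
  {net : Network N S W} {M : ℝ} {P : Measure Ω} {ℱ : Filtration ℕ mΩ}
  {C : ℕ → Ω → (N → S) × (ULink N → W)} {G : ℝ} {R : Run N Ω}
  {Rc : Set (N → ℝ)} {L : Set (ULink N → ℝ)} [IsProbabilityMeasure P]

theorem eventually_add_mul_le_sq (A D : ℝ) {e : ℝ} (he : 0 < e) :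
    ∀ᶠ T : ℕ in atTop, A + T * D ≤ (e * T) ^ 2 := by
  filter_upwards [eventually_ge_atTop 1,
    tendsto_natCast_atTop_atTop.eventually_ge_atTop ((|A| + |D|) / e ^ 2)] with T h1 h2
  have hT : (1 : ℝ) ≤ T := by exact_mod_cast h1
  rw [div_le_iff₀ (by positivity)] at h2
  have h3 : |A| + |D| * T ≤ (|A| + |D|) * T := by nlinarith [abs_nonneg A]
  nlinarith [le_abs_self A, le_abs_self D]

namespace BoundedRun

theorem integrable_y (h : BoundedRun net M P ℱ C G R) (t : ℕ) (k : N) :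
    Integrable (fun ω => R.y t ω k) P :=
  integrable_of_mem_Icc (h.measurable_y t k) fun ω => h.y_mem t ω k

theorem integrable_gs (h : BoundedRun net M P ℱ C G R) (t : ℕ) (k n : N) :
    Integrable (fun ω => R.gs t ω k n) P :=
  integrable_of_mem_Icc (h.measurable_gs t k n) fun ω => h.gs_mem t ω k n

theorem integrable_gl (h : BoundedRun net M P ℱ C G R) (t : ℕ) {k n : N} (hkn : k ≠ n) :
    Integrable (fun ω => R.gl t ω k n) P :=
  integrable_of_mem_Icc (h.measurable_gl t k n) fun ω => h.gl_mem t ω k n hkn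

omit [IsProbabilityMeasure P] in
theorem a_mem (h : BoundedRun net M P ℱ C G R) (t : ℕ) (ω : Ω) (k n : N) :
    R.a t ω k n ∈ Set.Icc 0 G := by
  refine ⟨h.dynamics.a_nonneg t ω k n, ?_⟩
  rcases eq_or_ne k n with rfl | hkn
  · exact (h.dynamics.a_sink_le t ω k).trans (h.gs_mem t ω k k).2
  · exact (h.dynamics.a_link_le t ω k n hkn).trans (h.gl_mem t ω k n hkn).2

theorem integrable_a (h : BoundedRun net M P ℱ C G R) (t : ℕ) (k n : N) :
    Integrable (fun ω => R.a t ω k n) P :=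
  integrable_of_mem_Icc (h.measurable_a t k n) fun ω => h.a_mem t ω k n

/-- What was admitted has left the queue or is still there. -/
theorem sum_integral_y (h : BoundedRun net M P ℱ C G R) (k : N) (T : ℕ) :
    ∑ t ∈ range T, ∫ ω, R.y t ω k ∂P = ∑ n, ∑ t ∈ range T, ∫ ω, R.a t ω k n ∂P +
      (∫ ω, R.lam T ω k ∂P - ∫ ω, R.lam 0 ω k ∂P) := by
  induction T with
  | zero => simp
  | succ T ih =>
    have hpt : ∀ ω, R.lam (T + 1) ω k = R.lam T ω k - ∑ n, R.a T ω k n + R.y T ω k := by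
      intro ω
      rw [h.dynamics.lam_succ, h.dynamics.a_total]
      rcases le_total (R.lam T ω k) (offered (R.gs T ω) (R.gl T ω) k) with hle | hle
      · rw [max_eq_right (by linarith), min_eq_left hle]
        ring
      · rw [max_eq_left (by linarith), min_eq_right hle]
    have hint : ∫ ω, R.lam (T + 1) ω k ∂P =
        ∫ ω, R.lam T ω k ∂P - ∑ n, ∫ ω, R.a T ω k n ∂P + ∫ ω, R.y T ω k ∂P := by
      have i1 : Integrable (fun ω => ∑ n, R.a T ω k n) P :=
        integrable_finsetSum _ fun n _ => h.integrable_a T k n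
      have i2 : Integrable (fun ω => R.lam T ω k - ∑ n, R.a T ω k n) P :=
        (h.integrable_lam T k).sub i1
      simp only [hpt]
      rw [integral_add i2 (h.integrable_y T k), integral_sub (h.integrable_lam T k) i1,
        integral_finsetSum _ fun n _ => h.integrable_a T k n]
    simp only [Finset.sum_range_succ, Finset.sum_add_distrib]
    linarith

/-- What has arrived at a relay queue has left it or is still there. -/
theorem sum_integral_a_le (h : BoundedRun net M P ℱ C G R) {n k : N} (hnk : n ≠ k) (T : ℕ) :
    ∑ t ∈ range T, ∫ ω, R.a t ω k n ∂P ≤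
      ∑ t ∈ range T, ∫ ω, R.gs t ω n k ∂P + ∫ ω, R.eta T ω n k ∂P := by
  induction T with
  | zero => simpa using integral_nonneg fun ω => h.dynamics.eta_nonneg 0 ω n k hnk
  | succ T ih =>
    have i1 : Integrable (fun ω => R.eta T ω n k - R.gs T ω n k) P :=
      (h.integrable_eta T hnk).sub (h.integrable_gs T n k)
    have hint : ∫ ω, (R.eta T ω n k - R.gs T ω n k + R.a T ω k n) ∂P ≤
        ∫ ω, R.eta (T + 1) ω n k ∂P := by
      refine integral_mono (i1.add (h.integrable_a T k n)) (h.integrable_eta _ hnk) fun ω => ?_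
      exact (add_le_add_left (le_max_left _ _) _).trans (h.dynamics.eta_succ_ge T ω n k hnk)
    rw [integral_add i1 (h.integrable_a T k n),
      integral_sub (h.integrable_eta T hnk) (h.integrable_gs T n k)] at hint
    simp only [Finset.sum_range_succ]
    linarith

/-- Integrate `2bq ≤ b² + q²`. -/
theorem integral_le_of_sq_le (h : BoundedRun net M P ℱ C G R) {q : Ω → ℝ} {T : ℕ}
    (hq : Integrable q P) (hle : ∀ ω, q ω ^ 2 ≤ lyapunov (R.lam T ω) (R.eta T ω) (R.Q T ω)) {b : ℝ}
    (hb : 0 < b) (hL : ∫ ω, lyapunov (R.lam T ω) (R.eta T ω) (R.Q T ω) ∂P ≤ b ^ 2) :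
    ∫ ω, q ω ∂P ≤ b := by
  have h1 : ∫ ω, (2 * b) * q ω ∂P ≤
      ∫ ω, (b ^ 2 + lyapunov (R.lam T ω) (R.eta T ω) (R.Q T ω)) ∂P := by
    refine integral_mono (hq.const_mul _) ((integrable_const _).add (h.integrable_lyapunov T))
      fun ω => ?_
    have := hle ω
    simp only
    nlinarith [sq_nonneg (q ω - b)]
  rw [integral_const_mul, integral_add (integrable_const _) (h.integrable_lyapunov T)] at h1
  simp only [integral_const, probReal_univ, one_smul] at h1
  nlinarith

/-- Jensen's inequality for the admitted rates. -/
theorem avg_utility_le (h : BoundedRun net M P ℱ C G R)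
    (hU : ∀ k, ConcaveOn ℝ (Set.Ici 0) (net.U k))
    (hUc : ∀ k, ContinuousOn (net.U k) (Set.Ici 0)) (k : N) {T : ℕ} (hT : 0 < T) :
    (1 / (T : ℝ)) * ∑ t ∈ range T, ∫ ω, net.U k (R.y t ω k) ∂P ≤
      net.U k (avgAdmitted P R T k) := by
  have hT' : (0 : ℝ) < T := by exact_mod_cast hT
  -- Jensen is applied twice: to the expectation in each slot, then to the average over slots.
  have h1 : ∀ t, ∫ ω, net.U k (R.y t ω k) ∂P ≤ net.U k (∫ ω, R.y t ω k ∂P) := fun t =>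
    (hU k).le_map_integral (hUc k) isClosed_Ici (Eventually.of_forall fun ω => (h.y_mem t ω k).1)
      (h.integrable_y t k) (h.integrable_utility hUc t k)
  have h2 := (hU k).le_map_sum (t := range T) (w := fun _ => 1 / (T : ℝ))
    (p := fun t => ∫ ω, R.y t ω k ∂P) (fun _ _ => by positivity) (by simp [hT'.ne'])
    fun t _ => Set.mem_Ici.2 (integral_nonneg fun ω => (h.y_mem t ω k).1)
  simp only [smul_eq_mul, ← Finset.mul_sum] at h2
  refine le_trans ?_ h2
  gcongr with t _
  exact h1 t

theorem avgAdmitted_mem (h : BoundedRun net M P ℱ C G R) {T : ℕ} (hT : 0 < T) :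
    (fun k => avgAdmitted P R T k) ∈ Set.Icc 0 net.Rmax := by
  have hT' : (0 : ℝ) < T := by exact_mod_cast hT
  refine ⟨fun k => ?_, fun k => ?_⟩
  · exact mul_nonneg (by positivity)
      (Finset.sum_nonneg fun t _ => integral_nonneg fun ω => (h.y_mem t ω k).1)
  · have h1 : ∑ t ∈ range T, ∫ ω, R.y t ω k ∂P ≤ ∑ t ∈ range T, net.Rmax k := by
      refine Finset.sum_le_sum fun t _ => ?_
      have := integral_mono (h.integrable_y t k) (integrable_const (net.Rmax k))
        fun ω => (h.rate t ω k).1.2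
      simpa using this
    rw [Finset.sum_const, card_range, nsmul_eq_mul] at h1
    simp only [avgAdmitted]
    rw [one_div, inv_mul_le_iff₀ hT']
    exact h1

end BoundedRun

namespace OptimalRun

theorem integral_lyapunov_le (h : OptimalRun net M P ℱ C G Rc L R)
    (hUc : ∀ k, ContinuousOn (net.U k) (Set.Ici 0)) (hR : ∀ k, ∀ r ∈ Rc, ∑ n, r n ≤ net.Rmax k)
    {z : N → ℝ} (hz : z ∈ feasibleRates Rc L) (T : ℕ) :
    ∫ ω, lyapunov (R.lam T ω) (R.eta T ω) (R.Q T ω) ∂P ≤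
      ∫ ω, lyapunov (R.lam 0 ω) (R.eta 0 ω) (R.Q 0 ω) ∂P + T * driftBound N G +
        2 * M * (∑ t ∈ range T, ∑ k, ∫ ω, net.U k (R.y t ω k) ∂P - T * ∑ k, net.U k (z k)) := by
  induction T with
  | zero => simp
  | succ T ih =>
    have := h.integral_lyapunov_succ_le hUc hR hz T
    rw [Finset.sum_range_succ]
    push_cast
    linarith

/-- The average utility is close to that of every feasible rate vector. -/
theorem eventually_utility_ge (h : OptimalRun net M P ℱ C G Rc L R) (hM : 0 < M)
    (hU : ∀ k, ConcaveOn ℝ (Set.Ici 0) (net.U k))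
    (hUc : ∀ k, ContinuousOn (net.U k) (Set.Ici 0)) (hR : ∀ k, ∀ r ∈ Rc, ∑ n, r n ≤ net.Rmax k)
    {z : N → ℝ} (hz : z ∈ feasibleRates Rc L) {δ : ℝ} (hδ : driftBound N G < 2 * M * δ) :
    ∀ᶠ T in atTop, ∑ k, net.U k (z k) - δ ≤ ∑ k, net.U k (avgAdmitted P R T k) := by
  set A := ∫ ω, lyapunov (R.lam 0 ω) (R.eta 0 ω) (R.Q 0 ω) ∂P
  -- From this time on, the margin `T (2Mδ - B)` absorbs the initial energy `A`.
  filter_upwards [eventually_gt_atTop 0, tendsto_natCast_atTop_atTop.eventually_ge_atTop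
    (A / (2 * M * δ - driftBound N G))] with T hT hTA
  have hT' : (0 : ℝ) < T := by exact_mod_cast hT
  rw [div_le_iff₀ (by linarith)] at hTA
  have h1 := h.integral_lyapunov_le hUc hR hz T
  have h2 : 0 ≤ ∫ ω, lyapunov (R.lam T ω) (R.eta T ω) (R.Q T ω) ∂P :=
    integral_nonneg fun ω => lyapunov_nonneg _ _ _
  have h3 := Finset.sum_le_sum fun k (_ : k ∈ univ) => h.avg_utility_le hU hUc k hT
  rw [← Finset.mul_sum, Finset.sum_comm, one_div, inv_mul_le_iff₀ hT'] at h3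
  set X := ∑ t ∈ range T, ∑ k, ∫ ω, net.U k (R.y t ω k) ∂P
  set u := ∑ k, net.U k (z k)
  set v := ∑ k, net.U k (avgAdmitted P R T k)
  have h4 : 0 ≤ 2 * M * (T * δ + X - T * u) := by linarith
  have h5 : 0 ≤ T * δ + X - T * u := nonneg_of_mul_nonneg_right h4 (by positivity)
  have h6 : 0 ≤ T * (δ + v - u) := by linarith
  have h7 := nonneg_of_mul_nonneg_right h6 hT'
  linarith

/-- The expected queues grow at most like the square root of the time. -/
theorem exists_integral_lyapunov_le (h : OptimalRun net M P ℱ C G Rc L R) (hM : 0 < M)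
    (hUc : ∀ k, ContinuousOn (net.U k) (Set.Ici 0)) (hR : ∀ k, ∀ r ∈ Rc, ∑ n, r n ≤ net.Rmax k)
    (hne : (feasibleRates Rc L).Nonempty) :
    ∃ A D : ℝ, ∀ T : ℕ, ∫ ω, lyapunov (R.lam T ω) (R.eta T ω) (R.Q T ω) ∂P ≤ A + T * D := by
  obtain ⟨z, hz⟩ := hne
  -- Bounded utilities alone give linear growth of the energy; no interior point of the feasible set
  -- is needed.
  have hb : ∀ k, ∃ b, ∀ v ∈ Set.Icc 0 G, ‖net.U k v‖ ≤ b := fun k =>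
    isCompact_Icc.exists_bound_of_continuousOn ((hUc k).mono fun v hv => hv.1)
  choose b hb using hb
  have hu : ∀ t, ∑ k, ∫ ω, net.U k (R.y t ω k) ∂P ≤ ∑ k, b k := fun t => by
    refine Finset.sum_le_sum fun k _ => ?_
    have := integral_mono (h.integrable_utility hUc t k) (integrable_const (b k))
      fun ω => (le_abs_self _).trans (hb k _ (h.y_mem t ω k))
    simpa using this
  refine ⟨∫ ω, lyapunov (R.lam 0 ω) (R.eta 0 ω) (R.Q 0 ω) ∂P,
    driftBound N G + 2 * M * (∑ k, b k - ∑ k, net.U k (z k)), fun T => ?_⟩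
  have h1 := h.integral_lyapunov_le hUc hR hz T
  have h2 := Finset.sum_le_sum fun t (_ : t ∈ range T) => hu t
  rw [Finset.sum_const, card_range, nsmul_eq_mul] at h2
  have h3 := mul_le_mul_of_nonneg_left h2 (show 0 ≤ 2 * M by positivity)
  linarith

/-- Linearly growing energy is eventually below `(e T)²`. The queues `Q` are left out, as the flow
balances below involve only `λ` and `η`. -/
theorem eventually_queues_le (h : OptimalRun net M P ℱ C G Rc L R) (hM : 0 < M)
    (hUc : ∀ k, ContinuousOn (net.U k) (Set.Ici 0)) (hR : ∀ k, ∀ r ∈ Rc, ∑ n, r n ≤ net.Rmax k)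
    (hne : (feasibleRates Rc L).Nonempty) {e : ℝ} (he : 0 < e) :
    ∀ᶠ T : ℕ in atTop, (∀ k, ∫ ω, R.lam T ω k ∂P ≤ e * T) ∧
      ∀ n k, n ≠ k → ∫ ω, R.eta T ω n k ∂P ≤ e * T := by
  obtain ⟨A, D, hAD⟩ := h.exists_integral_lyapunov_le hM hUc hR hne
  filter_upwards [eventually_gt_atTop 0, eventually_add_mul_le_sq A D he] with T hT hle
  have hT' : (0 : ℝ) < T := by exact_mod_cast hT
  have hL := (hAD T).trans hle
  exact ⟨fun k => h.integral_le_of_sq_le (h.integrable_lam T k)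
      (fun ω => lam_sq_le_lyapunov _ _ _ k) (by positivity) hL,
    fun n k hnk => h.integral_le_of_sq_le (h.integrable_eta T hnk)
      (fun ω => eta_sq_le_lyapunov _ _ _ hnk) (by positivity) hL⟩

/-- The average admitted rates are close to feasible rates. -/
theorem eventually_near_feasible (h : OptimalRun net M P ℱ C G Rc L R) (hM : 0 < M)
    (hUc : ∀ k, ContinuousOn (net.U k) (Set.Ici 0)) (hR : ∀ k, ∀ r ∈ Rc, ∑ n, r n ≤ net.Rmax k)
    (hne : (feasibleRates Rc L).Nonempty) (hRc : Convex ℝ Rc) (hL : Convex ℝ L)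
    (hLlow : ∀ v ∈ L, ∀ w, 0 ≤ w → w ≤ v → w ∈ L) {δ : ℝ} (hδ : 0 < δ) :
    ∀ᶠ T in atTop, ∃ b ∈ feasibleRates Rc L, ∀ k, |avgAdmitted P R T k - b k| ≤ δ := by
  -- From above, the deviation is made of `|N|` link losses and the content of `λ_k` at time `T`,
  -- each at most `e`. From below, only the initial queue matters.
  set e := δ / (Fintype.card N + 1) with he
  have he0 : 0 < e := by positivity
  have hlam0 : ∀ᶠ T : ℕ in atTop, ∀ k, ∫ ω, R.lam 0 ω k ∂P ≤ δ * T := by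
    refine eventually_all.2 fun k => ?_
    filter_upwards [tendsto_natCast_atTop_atTop.eventually_ge_atTop
      ((∫ ω, R.lam 0 ω k ∂P) / δ)] with T hT
    rw [div_le_iff₀ hδ] at hT
    linarith
  filter_upwards [eventually_gt_atTop 0, hlam0, h.eventually_queues_le hM hUc hR hne he0]
    with T hT hT0 hTq
  obtain ⟨hTl, hTe⟩ := hTq
  have hT' : (0 : ℝ) < T := by exact_mod_cast hT
  set c : ℝ := 1 / T with hc
  have hc0 : 0 < c := by positivity
  have hcT : c * T = 1 := by simp [hc, hT'.ne']
  have hw : ∑ _t ∈ range T, c = 1 := by simpa [mul_comm] using hcT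
  choose r hr hrgs using h.cell_mem
  set α : N → N → ℝ := fun k n => c * ∑ t ∈ range T, ∫ ω, R.a t ω k n ∂P with hα
  set σ : N → N → ℝ := fun n k => c * ∑ t ∈ range T, ∫ ω, R.gs t ω n k ∂P with hσ
  have hα0 : ∀ k n, 0 ≤ α k n := fun k n => mul_nonneg hc0.le
    (Finset.sum_nonneg fun t _ => integral_nonneg fun ω => (h.a_mem t ω k n).1)
  have hσ0 : ∀ n k, 0 ≤ σ n k := fun n k => mul_nonneg hc0.le
    (Finset.sum_nonneg fun t _ => integral_nonneg fun ω => (h.gs_mem t ω n k).1)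
  have hασ : ∀ k n, α k n ≤ σ n k + e := by
    intro k n
    rcases eq_or_ne n k with rfl | hnk
    · have h1 : α n n ≤ σ n n := by
        exact mul_le_mul_of_nonneg_left (Finset.sum_le_sum fun t _ =>
          integral_mono (h.integrable_a t n n) (h.integrable_gs t n n)
            fun ω => h.dynamics.a_sink_le t ω n) hc0.le
      linarith
    · have h1 := mul_le_mul_of_nonneg_left ((h.sum_integral_a_le hnk T).trans
        (add_le_add_right (hTe n k hnk) _)) hc0.le
      calc α k n ≤ c * (∑ t ∈ range T, ∫ ω, R.gs t ω n k ∂P + e * T) := h1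
        _ = σ n k + e * (c * T) := by simp only [hσ]; ring
        _ = σ n k + e := by rw [hcT, mul_one]
  -- Actual transfers `α` respect the local region and offered services `σ` the cellular one, so the
  -- minimum respects both. The balance of `η` shows that it loses at most `e` against `α`.
  set g : N → N → ℝ := fun n k => min (α k n) (σ n k) with hg
  refine ⟨fun k => ∑ n, g n k, ⟨g, ∑ t ∈ range T, c • r t,
    hRc.sum_mem (fun _ _ => hc0.le) hw fun t _ => hr t, fun n k => ⟨?_, ?_⟩, ?_, rfl⟩, fun k => ?_⟩
  · exact le_min (hα0 k n) (hσ0 n k)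
  · refine (min_le_right _ _).trans ?_
    rw [Finset.sum_apply]
    simp only [hσ, Pi.smul_apply, smul_eq_mul, ← Finset.mul_sum]
    gcongr with t _
    exact hrgs t n k
  · refine hLlow _ (hL.sum_mem (t := range T) (fun _ _ => hc0.le) hw fun t _ => h.local_mem t) _
      (fun e => le_min (hα0 _ _) (hσ0 _ _)) fun e => (min_le_left _ _).trans ?_
    rw [Finset.sum_apply]
    simp only [hα, Pi.smul_apply, smul_eq_mul, ← Finset.mul_sum]
    exact mul_le_mul_of_nonneg_left (Finset.sum_le_sum fun t _ =>
      integral_mono (h.integrable_a t _ _) (h.integrable_gl t e.2)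
        fun ω => h.dynamics.a_link_le t ω _ _ e.2) hc0.le
  · have h1 : avgAdmitted P R T k = ∑ n, α k n +
        (c * ∫ ω, R.lam T ω k ∂P - c * ∫ ω, R.lam 0 ω k ∂P) := by
      rw [avgAdmitted, h.sum_integral_y]
      simp only [hα, ← Finset.mul_sum]
      ring
    have h2 : ∑ n, g n k ≤ ∑ n, α k n := Finset.sum_le_sum fun n _ => min_le_left _ _
    have h3 : ∑ n, α k n ≤ ∑ n, g n k + Fintype.card N * e := by
      have : ∑ n, α k n ≤ ∑ n, (g n k + e) := by
        refine Finset.sum_le_sum fun n _ => ?_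
        rw [← sub_le_iff_le_add]
        exact le_min (by linarith) (by linarith [hασ k n])
      simpa [Finset.sum_add_distrib] using this
    have h4 : c * ∫ ω, R.lam T ω k ∂P ≤ e := by
      calc c * ∫ ω, R.lam T ω k ∂P ≤ c * (e * T) := by gcongr; exact hTl k
        _ = e * (c * T) := by ring
        _ = e := by rw [hcT, mul_one]
    have h5 : c * ∫ ω, R.lam 0 ω k ∂P ≤ δ := by
      calc c * ∫ ω, R.lam 0 ω k ∂P ≤ c * (δ * T) := by gcongr; exact hT0 k
        _ = δ * (c * T) := by ring
        _ = δ := by rw [hcT, mul_one]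
    have h6 : 0 ≤ c * ∫ ω, R.lam T ω k ∂P :=
      mul_nonneg hc0.le (integral_nonneg fun ω => h.dynamics.lam_nonneg T ω k)
    have h7 : 0 ≤ c * ∫ ω, R.lam 0 ω k ∂P :=
      mul_nonneg hc0.le (integral_nonneg fun ω => h.dynamics.lam_nonneg 0 ω k)
    have h8 : (Fintype.card N + 1) * e = δ := by
      rw [he]
      field_simp
    rw [abs_le]
    constructor <;> linarith

/-- If near-feasible rates of nearly optimal utility are close to `z`, then so are the average
admitted rates. -/
theorem eventually_abs_avgAdmitted_sub_le (h : OptimalRun net M P ℱ C G Rc L R)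
    (hU : ∀ k, ConcaveOn ℝ (Set.Ici 0) (net.U k))
    (hUc : ∀ k, ContinuousOn (net.U k) (Set.Ici 0)) (hR : ∀ k, ∀ r ∈ Rc, ∑ n, r n ≤ net.Rmax k)
    (hRc : Convex ℝ Rc) (hL : Convex ℝ L) (hLlow : ∀ v ∈ L, ∀ w, 0 ≤ w → w ≤ v → w ∈ L)
    {z : N → ℝ} (hz : z ∈ feasibleRates Rc L) {ε δ : ℝ} (hδ : 0 < δ)
    (hMδ : 0 < M ∧ driftBound N G < 2 * M * δ ∧
        ∀ a ∈ Set.Icc 0 net.Rmax, ∀ b ∈ feasibleRates Rc L, (∀ k, |a k - b k| ≤ δ) →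
          ∑ k, net.U k (z k) - δ ≤ ∑ k, net.U k (a k) → ∀ k, |a k - z k| ≤ ε) :
    ∀ᶠ T in atTop, ∀ k, |avgAdmitted P R T k - z k| ≤ ε := by
  obtain ⟨hM, hB, hnear⟩ := hMδ
  filter_upwards [eventually_gt_atTop 0, h.eventually_utility_ge hM hU hUc hR hz hB,
    h.eventually_near_feasible hM hUc hR ⟨z, hz⟩ hRc hL hLlow hδ] with T hT hu ⟨b, hb, hab⟩
  exact hnear _ (h.avgAdmitted_mem hT) b hb hab hu

end OptimalRun

omit [DecidableEq N] [MeasurableSpace S] [MeasurableSpace W] in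
/-- The optimum exists, is unique, and is approached by all runs with optimal schedulers. -/
theorem exists_optimum_and_threshold (hU : ∀ k, StrictConcaveOn ℝ (Set.Ici 0) (net.U k))
    (hUc : ∀ k, ContinuousOn (net.U k) (Set.Ici 0)) (hR : ∀ k, ∀ r ∈ Rc, ∑ n, r n ≤ net.Rmax k)
    (hRc : Convex ℝ Rc) (hRck : IsCompact Rc) (hRc0 : 0 ∈ Rc) (hL : Convex ℝ L) (hLc : IsClosed L)
    (hL0 : 0 ∈ L) (G : ℝ) :
    ∃ y ∈ feasibleRates Rc L,
      (∀ z ∈ feasibleRates Rc L, ∑ k, net.U k (z k) ≤ ∑ k, net.U k (y k)) ∧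
      (∀ z ∈ feasibleRates Rc L, ∑ k, net.U k (y k) ≤ ∑ k, net.U k (z k) → z = y) ∧
      ∀ ε > 0, ∃ δ > 0, ∃ M₀ > 0, ∀ M ≥ M₀, 0 < M ∧ driftBound N G < 2 * M * δ ∧
        ∀ a ∈ Set.Icc 0 net.Rmax, ∀ b ∈ feasibleRates Rc L, (∀ k, |a k - b k| ≤ δ) →
          ∑ k, net.U k (y k) - δ ≤ ∑ k, net.U k (a k) → ∀ k, |a k - y k| ≤ ε := by
  have hFR := feasibleRates_le (L := L) hR
  have hFk := isCompact_feasibleRates hRck hLc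
  have hne : (feasibleRates Rc L).Nonempty :=
    ⟨_, 0, 0, hRc0, fun k n => ⟨le_rfl, le_rfl⟩, hL0, rfl⟩
  obtain ⟨y, hy, hmax, huniq⟩ := exists_unique_optimum hU hUc hFk (convex_feasibleRates hRc hL) hne
    fun z hz => (hFR hz).1
  refine ⟨y, hy, hmax, huniq, fun ε hε => ?_⟩
  have hφ : ContinuousOn (fun y : N → ℝ => ∑ k, net.U k (y k)) (Set.Icc 0 net.Rmax) :=
    continuousOn_finsetSum _ fun k _ =>
      (hUc k).comp (continuous_apply k).continuousOn fun z hz => hz.1 k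
  obtain ⟨δ, hδ, hδF⟩ := exists_near_maximizer_dist_le (y := y) isCompact_Icc hFk hFR hφ
    (fun z hz hle => by rw [huniq z hz hle, dist_self]) hε
  -- The second entry makes `2Mδ` at least the drift bound plus one, the first makes `M` positive.
  refine ⟨δ, hδ, max 1 ((driftBound N G + 1) / (2 * δ)), lt_max_of_lt_left one_pos,
    fun M hM => ⟨?_, ?_, fun a ha b hb hab hφa k => ?_⟩⟩
  · exact one_pos.trans_le ((le_max_left _ _).trans hM)
  · have h1 := (le_max_right _ _).trans hM
    rw [div_le_iff₀ (by positivity)] at h1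
    linarith
  · have h1 := hδF a ha b hb ((dist_pi_le_iff hδ.le).2 fun k => by
      rw [Real.dist_eq]; exact hab k) hφa
    have h2 := (dist_pi_le_iff hε.le).1 h1 k
    rwa [Real.dist_eq] at h2

end DcC

/-! ### Comparison with stationary schedules -/

namespace DcC

variable {N S W : Type*} [Fintype N] [DecidableEq N]

theorem sum_mul_le_of_mem_convexHull {ι : Type*} [Fintype ι] {s : Set (ι → ℝ)} {c : ι → ℝ} {m : ℝ}
    (h : ∀ r ∈ s, ∑ i, c i * r i ≤ m) {x : ι → ℝ} (hx : x ∈ convexHull ℝ s) :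
    ∑ i, c i * x i ≤ m := by
  have hlin : IsLinearMap ℝ fun r : ι → ℝ => ∑ i, c i * r i :=
    ⟨fun r r' => by simp [mul_add, Finset.sum_add_distrib],
      fun a r => by simp [Finset.mul_sum, mul_left_comm]⟩
  have hsub : s ⊆ {r | ∑ i, c i * r i ≤ m} := fun r hr => h r hr
  exact convexHull_min hsub (convex_halfSpace_le hlin m) hx

theorem measurable_cellObjective {Ω : Type*} {m : MeasurableSpace Ω} {lam : Ω → N → ℝ}
    {eta Q : Ω → N → N → ℝ} (hl : Measurable lam) (he : Measurable eta) (hQ : Measurable Q)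
    (k : N) (v : N → ℝ) : Measurable fun ω => cellObjective (lam ω) (eta ω) (Q ω) k v := by
  unfold cellObjective
  fun_prop

section Independence

variable {Ω : Type*} [mΩ : MeasurableSpace Ω] [MeasurableSpace S] [MeasurableSpace W]
  {P : Measure Ω} {ℱ : Filtration ℕ mΩ}
  {C : ℕ → Ω → (N → S) × (ULink N → W)} {R : Run N Ω}

omit [Fintype N] [DecidableEq N] in
theorem Causal.indepFun (hc : Causal P ℱ C R) (t : ℕ) {q : Ω → ℝ} (hq : Measurable[ℱ t] q)
    {X : Type*} [MeasurableSpace X] {x : (N → S) × (ULink N → W) → X} (hx : Measurable x) :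
    IndepFun q (fun ω => x (C t ω)) P := by
  rw [IndepFun_iff_Indep]
  refine indep_of_indep_of_le_left (indep_of_indep_of_le_right (hc.indep t) ?_) hq.comap_le
  have : MeasurableSpace.comap (fun ω => x (C t ω)) inferInstance =
      MeasurableSpace.comap (C t) (MeasurableSpace.comap x inferInstance) := by
    rw [MeasurableSpace.comap_comp]
    rfl
  rw [this]
  exact MeasurableSpace.comap_mono hx.comap_le

omit [Fintype N] [DecidableEq N] in
/-- Weights that are determined by the past: the average rates `r` cannot do better, in expectation,
than a value `obj` that bounds what is possible in every channel state. -/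
theorem Causal.integral_sum_mul_le [IsProbabilityMeasure P] (hc : Causal P ℱ C R)
    {ν : Measure ((N → S) × (ULink N → W))} (hC : IIDChannel P ν C) (t : ℕ)
    {X ι : Type*} [MeasurableSpace X] [Fintype ι] {Γ : X → Set (ι → ℝ)}
    {Z : (N → S) × (ULink N → W) → X} (hZ : Measurable Z) {r : ι → ℝ}
    (hr : r ∈ avgRegion (ν.map Z) Γ) {c : Ω → ι → ℝ}
    (hcm : ∀ i, Measurable[ℱ t] fun ω => c ω i) (hci : ∀ i, Integrable (fun ω => c ω i) P)
    {obj : Ω → ℝ} (hobj : Integrable obj P)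
    (hle : ∀ ω, ∀ x ∈ Γ (Z (C t ω)), ∑ i, c ω i * x i ≤ obj ω) :
    ∫ ω, ∑ i, c ω i * r i ∂P ≤ ∫ ω, obj ω ∂P := by
  obtain ⟨ρ, hρ, hρi, hρΓ, rfl⟩ := hr
  have hZC : Measurable fun ω => Z (C t ω) := hZ.comp (hC.measurable t)
  have hlaw : ν.map Z = P.map fun ω => Z (C t ω) := by
    rw [← hC.law t, Measure.map_map hZ (hC.measurable t)]
    rfl
  rw [hlaw] at hρi hρΓ ⊢
  have hae : ∀ᵐ ω ∂P, ρ (Z (C t ω)) ∈ convexHull ℝ (Γ (Z (C t ω))) :=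
    ae_of_ae_map hZC.aemeasurable hρΓ
  have hρi' : ∀ i, Integrable (fun ω => ρ (Z (C t ω)) i) P := fun i =>
    (hρi.eval i).comp_measurable hZC
  have hρr : ∀ i, (∫ x, ρ x ∂(P.map fun ω => Z (C t ω))) i = ∫ ω, ρ (Z (C t ω)) i ∂P := by
    intro i
    rw [integral_apply_of_integrable hρi]
    exact integral_map hZC.aemeasurable ((measurable_pi_apply i).comp hρ).aestronglyMeasurable
  have hind : ∀ i, IndepFun (fun ω => c ω i) (fun ω => ρ (Z (C t ω)) i) P := fun i =>
    hc.indepFun t (hcm i) (x := fun s => ρ (Z s) i)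
      ((measurable_pi_apply i).comp (hρ.comp hZ))
  have hint : ∀ i, Integrable (fun ω => c ω i * ρ (Z (C t ω)) i) P := fun i =>
    (hind i).integrable_mul (hci i) (hρi' i)
  -- By independence the product of the means is the mean of the product. The selection lies in the
  -- convex hull, where a linear objective is bounded by its bound on the feasible rates.
  calc ∫ ω, ∑ i, c ω i * (∫ x, ρ x ∂(P.map fun ω => Z (C t ω))) i ∂P
      = ∑ i, (∫ ω, c ω i ∂P) * ∫ ω, ρ (Z (C t ω)) i ∂P := by
        rw [integral_finsetSum _ fun i _ => (hci i).mul_const _]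
        refine Finset.sum_congr rfl fun i _ => ?_
        rw [integral_mul_const, hρr]
    _ = ∫ ω, ∑ i, c ω i * ρ (Z (C t ω)) i ∂P := by
        rw [integral_finsetSum _ fun i _ => hint i]
        refine Finset.sum_congr rfl fun i _ => ?_
        exact ((hind i).integral_mul_eq_mul_integral (hci i).aestronglyMeasurable
          (hρi' i).aestronglyMeasurable).symm
    _ ≤ ∫ ω, obj ω ∂P := by
        refine integral_mono_ae (integrable_finsetSum _ fun i _ => hint i) hobj ?_
        filter_upwards [hae] with ω hω using sum_mul_le_of_mem_convexHull (hle ω) hω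

end Independence

/-! ### Cellular links -/

section Cellular

variable [MeasurableSpace S] {net : Network N S W}

omit [DecidableEq N] in
theorem isRateRegion_cellVec (hcell : ∀ k, IsRateRegion (net.cell k)) :
    IsRateRegion net.cellVec where
  measurable_graph := by
    have h : {p : (N → S) × (N → ℝ) | p.2 ∈ net.cellVec p.1} =
        ⋂ k, (fun p : (N → S) × (N → ℝ) => (p.1 k, p.2 k)) ⁻¹'
          {p : S × ℝ | p.2 ∈ net.cell k p.1} := by
      ext p
      simp [Network.cellVec]
    rw [h]
    exact MeasurableSet.iInter fun k => (hcell k).measurable_graph.preimage (by fun_prop)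
  isCompact c := by
    have h : net.cellVec c = Set.pi Set.univ fun k => net.cell k (c k) := by
      ext r
      simp [Network.cellVec]
    rw [h]
    exact isCompact_univ_pi fun k => (hcell k).isCompact _
  zero_mem c k := (hcell k).zero_mem _
  nonneg c r hr k := (hcell k).nonneg _ _ (hr k)
  lower c r hr r' h0 hle k := (hcell k).lower _ _ (hr k) _ (h0 k) (hle k)
  bounded := by
    choose G hG using fun k => (hcell k).bounded
    exact ⟨G, fun c r hr k => hG k _ _ (hr k)⟩

omit [DecidableEq N] [MeasurableSpace S] in
theorem mem_Icc_of_mem_cellChoices {k : N} {s : S} {G : ℝ} (hG : ∀ x ∈ net.cell k s, x ≤ G)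
    {v : N → ℝ} (hv : v ∈ net.cellChoices k s) (n : N) : v n ∈ Set.Icc 0 G :=
  ⟨hv.1 n, (le_ciSup (Set.finite_range v).bddAbove n).trans (hG _ hv.2)⟩

/-- In expectation, the cellular scheduler is at least as good as any stationary schedule. -/
theorem BoundedRun.integral_cellObjective_le {Ω : Type*} [mΩ : MeasurableSpace Ω]
    [MeasurableSpace W] {ν : Measure ((N → S) × (ULink N → W))} {M : ℝ} {P : Measure Ω}
    [IsProbabilityMeasure P] {ℱ : Filtration ℕ mΩ} {C : ℕ → Ω → (N → S) × (ULink N → W)} {G : ℝ}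
    {R : Run N Ω} (h : BoundedRun net M P ℱ C G R) (hC : IIDChannel P ν C)
    (hS : CellScheduler net C R) (hcell : ∀ k, IsRateRegion (net.cell k)) (t : ℕ)
    {g : N → N → ℝ} {r : N → ℝ} (hr : r ∈ avgRegion (ν.map Prod.fst) net.cellVec)
    (hg : ∀ k n, 0 ≤ g k n ∧ g k n ≤ r k) :
    ∫ ω, ∑ k, cellObjective (R.lam t ω) (R.eta t ω) (R.Q t ω) k (g k) ∂P ≤
      ∫ ω, ∑ k, cellObjective (R.lam t ω) (R.eta t ω) (R.Q t ω) k (R.gs t ω k) ∂P := by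
  have hscale : ∀ lam eta Q k (v : N → ℝ) x, cellObjective lam eta Q k v * x =
      cellObjective lam eta Q k fun n => v n * x := by
    intro lam eta Q k v x
    simp only [cellObjective, add_mul, Finset.sum_mul, mul_assoc]
  -- The stationary schedule gives each flow the fixed fraction `g k n / r k` of the current
  -- cellular rate. The objective is then linear in that rate, with weights known from the past, and
  -- the largest fraction keeps the link feasible.
  have hfrac : ∀ k n, g k n / r k ∈ Set.Icc 0 1 := fun k n =>
    ⟨div_nonneg (hg k n).1 ((hg k n).1.trans (hg k n).2),
      div_le_one_of_le₀ (hg k n).2 ((hg k n).1.trans (hg k n).2)⟩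
  have hgr : ∀ k n, g k n / r k * r k = g k n := by
    intro k n
    rcases eq_or_ne (r k) 0 with h0 | h0
    · have := le_antisymm (h0 ▸ (hg k n).2) (hg k n).1
      simp [this]
    · field_simp
  have key := h.causal.integral_sum_mul_le hC t measurable_fst hr
    (c := fun ω k => cellObjective (R.lam t ω) (R.eta t ω) (R.Q t ω) k fun n => g k n / r k)
    (obj := fun ω => ∑ k, cellObjective (R.lam t ω) (R.eta t ω) (R.Q t ω) k (R.gs t ω k))
    (fun k => measurable_cellObjective (h.causal.lam_meas t) (h.causal.eta_meas t)
      (h.causal.Q_meas t) k _)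
    (fun k => h.integrable_cellObjective t k (fun n => measurable_const) fun _ n => hfrac k n)
    (integrable_finsetSum _ fun k _ => h.integrable_cellObjective t k
      (fun n => h.measurable_gs t k n) fun ω n => h.gs_mem t ω k n)
    (fun ω x hx => Finset.sum_le_sum fun k _ => ?_)
  · simpa only [hscale, hgr] using key
  · rw [hscale]
    have hx0 : 0 ≤ x k := (hcell k).nonneg _ _ (hx k)
    have hv0 : ∀ n, 0 ≤ g k n / r k * x k := fun n => mul_nonneg (hfrac k n).1 hx0
    have : Nonempty N := ⟨k⟩
    refine isMaxOn_iff.1 (hS t ω k).2 _ ⟨hv0, (hcell k).lower _ _ (hx k) _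
      (Real.iSup_nonneg hv0) (ciSup_le fun n => ?_)⟩
    exact mul_le_of_le_one_left hx0 (hfrac k n).2

/-- The average cellular rates belong to the long-term average region. -/
theorem BoundedRun.exists_cell_mem {Ω : Type*} [mΩ : MeasurableSpace Ω]
    [MeasurableSpace W] {ν : Measure ((N → S) × (ULink N → W))} {M : ℝ} {P : Measure Ω}
    [IsProbabilityMeasure P] {ℱ : Filtration ℕ mΩ} {C : ℕ → Ω → (N → S) × (ULink N → W)} {G : ℝ}
    {R : Run N Ω} (h : BoundedRun net M P ℱ C G R) (hC : IIDChannel P ν C)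
    (hS : CellScheduler net C R) (hcell : ∀ k, IsRateRegion (net.cell k)) (t : ℕ) :
    ∃ r ∈ avgRegion (ν.map Prod.fst) net.cellVec, ∀ k n, ∫ ω, R.gs t ω k n ∂P ≤ r k := by
  have hm : ∀ k, Measurable fun ω => ⨆ n, R.gs t ω k n := fun k =>
    Measurable.iSup fun n => h.measurable_gs t k n
  have hZ : Measurable fun ω => (C t ω).1 := measurable_fst.comp (hC.measurable t)
  have hmem := (isRateRegion_cellVec hcell).integral_mem_avgRegion (P := P) hZ
    (g := fun ω k => ⨆ n, R.gs t ω k n) (measurable_pi_lambda _ hm)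
    fun ω k => (hS t ω k).1.2
  have hlaw : P.map (fun ω => (C t ω).1) = ν.map Prod.fst := by
    rw [← hC.law t, Measure.map_map measurable_fst (hC.measurable t)]
    rfl
  rw [hlaw] at hmem
  have hsup : ∀ ω k n, R.gs t ω k n ≤ ⨆ n, R.gs t ω k n := fun ω k n =>
    le_ciSup (Set.finite_range (R.gs t ω k)).bddAbove n
  have hint : ∀ k, Integrable (fun ω => ⨆ n, R.gs t ω k n) P := fun k =>
    integrable_of_mem_Icc (hm k) fun ω => ⟨(h.gs_mem t ω k k).1.trans (hsup ω k k),
      have : Nonempty N := ⟨k⟩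
      ciSup_le fun n => (h.gs_mem t ω k n).2⟩
  refine ⟨_, hmem, fun k n => ?_⟩
  rw [integral_apply_of_integrable (Integrable.of_eval hint)]
  exact integral_mono (h.integrable_gs t k n) (hint k) fun ω => hsup ω k n

/-- The two forms of the common constraints agree. -/
theorem exists_commonConstraints_iff {νc : Measure (N → S)}
    (hcell : ∀ k, IsRateRegion (net.cell k)) {L : Set (ULink N → ℝ)} (y : N → ℝ) :
    (∃ gs gl : N → N → ℝ, CommonConstraints net νc y gs gl ∧
      (fun e : ULink N => gl e.1.1 e.1.2) ∈ L) ↔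
    y ∈ feasibleRates (avgRegion νc net.cellVec) L := by
  constructor
  · rintro ⟨gs, gl, h, hL⟩
    have hgl : (fun e : ULink N => gs e.1.2 e.1.1) = fun e : ULink N => gl e.1.1 e.1.2 :=
      funext fun e => h.relay _ _ e.2.symm
    refine ⟨gs, _, h.cellular, fun k n => ⟨h.gs_nonneg k n,
      le_ciSup (Set.finite_range (gs k)).bddAbove n⟩, hgl ▸ hL, funext fun k => ?_⟩
    rw [← h.conservation k, ← Finset.add_sum_erase _ _ (mem_univ k)]
    congr 1
    exact Finset.sum_congr rfl fun n hn => (h.relay k n (Finset.ne_of_mem_erase hn)).symm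
  · rintro ⟨gs, r, hr, hgr, hL, rfl⟩
    refine ⟨gs, fun k n => gs n k, ⟨fun k n => (hgr k n).1, fun k n _ => (hgr n k).1,
      fun k => ?_, fun k n _ => rfl, ?_⟩, hL⟩
    · exact Finset.add_sum_erase _ (fun n => gs n k) (mem_univ k)
    -- The largest relayed rate may be below `r k`, but the average region is closed under lowering
    -- rates.
    · refine (isRateRegion_cellVec hcell).lower_avgRegion hr
        (fun k => Real.iSup_nonneg fun n => (hgr k n).1) fun k => ?_
      have : Nonempty N := ⟨k⟩
      exact ciSup_le fun n => (hgr k n).2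

end Cellular

theorem uniObjective_eq (lam : N → ℝ) (eta Q : N → N → ℝ) (gl : N → N → ℝ) :
    uniObjective lam eta Q (fun e : ULink N => gl e.1.1 e.1.2) = localObjective lam eta Q gl :=
  sum_uLink fun k n => (lam k - eta n k + Q n k) * gl k n

omit [Fintype N] [DecidableEq N] in
theorem measurable_weight {Ω : Type*} {m : MeasurableSpace Ω} {lam : Ω → N → ℝ}
    {eta Q : Ω → N → N → ℝ} (hl : Measurable lam) (he : Measurable eta) (hQ : Measurable Q)
    (k n : N) : Measurable fun ω => lam ω k - eta ω n k + Q ω n k := by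
  fun_prop

/-! ### Broadcast links and their addressees -/

section Broadcast

/-- Total weight of the links that are served by a broadcast. -/
def broadcastWeight (w : N → N → ℝ) (b : BLink N) : ℝ := ∑ k ∈ b.1.2, w k b.1.1

/-- The broadcast `(n, J)` serves exactly the links `(k, n)` with `k ∈ J`, which are genuine because
`n ∉ J`. So the local objective is linear in the broadcast rates. -/
theorem sum_mul_linkRate (w : N → N → ℝ) (f : BLink N → ℝ) :
    ∑ e : ULink N, w e.1.1 e.1.2 * linkRate f e.1.1 e.1.2 = ∑ b, broadcastWeight w b * f b := by
  simp only [linkRate, Finset.mul_sum]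
  rw [Finset.sum_comm]
  refine Finset.sum_congr rfl fun b _ => ?_
  rw [sum_uLink fun k n => w k n * if b.1.1 = n ∧ k ∈ b.1.2 then f b else 0, broadcastWeight,
    Finset.sum_mul, ← Finset.sum_subset (Finset.subset_univ b.1.2)]
  · refine Finset.sum_congr rfl fun k hk => ?_
    have hne : b.1.1 ≠ k := fun h => b.2.1 (h ▸ hk)
    rw [Finset.sum_eq_single_of_mem b.1.1 (by simp [hne])]
    · simp [hk]
    · intro n _ hn
      simp [hn.symm]
  · intro k _ hk
    simp [hk]

omit [Fintype N] in
theorem moveTo_apply (f : BLink N → ℝ) {e e' : BLink N} (h : e ≠ e') (b : BLink N) :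
    moveTo f e e' b = f b + (if b = e' then f e else 0) - (if b = e then f e else 0) := by
  unfold moveTo
  rcases eq_or_ne b e' with rfl | hb
  · simp [h.symm]
  · rcases eq_or_ne b e with rfl | hb'
    · simp [h]
    · simp [hb, hb']

/-- Addressees of negative weight can be dropped. -/
theorem exists_drop_addressees {X : Type*} [MeasurableSpace X] {Γ : X → Set (BLink N → ℝ)}
    (hΓ : IsRateRegion Γ) (hdrop : CanDropAddressees Γ) {c : X} (w : N → N → ℝ)
    {f : BLink N → ℝ} (hf : f ∈ Γ c) :
    ∃ f' ∈ Γ c, ∑ b, broadcastWeight (fun k n => max (w k n) 0) b * f b ≤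
      ∑ b, broadcastWeight w b * f' b := by
  set w' : N → N → ℝ := fun k n => max (w k n) 0 with hw'
  -- The broadcasts with a negatively weighted addressee are emptied one by one, without loss in the
  -- positive-part weight. Afterwards both weights agree wherever the rate is not zero.
  have hind : ∀ s : Finset (BLink N), ∃ f' ∈ Γ c,
      (∀ b ∈ s, (∃ k ∈ b.1.2, w k b.1.1 < 0) → f' b = 0) ∧
      ∑ b, broadcastWeight w' b * f b ≤ ∑ b, broadcastWeight w' b * f' b := by
    intro s
    induction s using Finset.induction_on with
    | empty => exact ⟨f, hf, by simp, le_rfl⟩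
    | insert e s _ ih =>
      obtain ⟨f', hf', hs, hle⟩ := ih
      have hf0 := hΓ.nonneg c f' hf'
      by_cases he : ∃ k ∈ e.1.2, w k e.1.1 < 0
      swap
      · refine ⟨f', hf', fun b hb hbad => ?_, hle⟩
        rcases Finset.mem_insert.1 hb with rfl | hb
        · exact absurd hbad he
        · exact hs b hb hbad
      set J := e.1.2.filter fun k => 0 ≤ w k e.1.1 with hJ
      have hweight : broadcastWeight w' e = ∑ k ∈ J, w' k e.1.1 := by
        rw [broadcastWeight, hJ, Finset.sum_filter]
        refine Finset.sum_congr rfl fun k _ => ?_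
        split_ifs with hk
        · rfl
        · exact max_eq_right (not_le.1 hk).le
      -- Without an addressee of nonnegative weight there is nothing to redirect to, but then the
      -- positive-part weight is zero and the rate can be set to zero.
      rcases J.eq_empty_or_nonempty with hJe | hJne
      · refine ⟨Function.update f' e 0, hΓ.lower c f' hf' _ (fun b => ?_) (fun b => ?_),
          fun b hb hbad => ?_, hle.trans (Finset.sum_le_sum fun b _ => ?_)⟩
        · rcases eq_or_ne b e with rfl | hb
          · simp
          · simpa [hb] using hf0 b
        · rcases eq_or_ne b e with rfl | hb
          · simpa using hf0 b
          · simp [hb]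
        · rcases eq_or_ne b e with rfl | hbe
          · simp
          · simpa [hbe] using hs b (Finset.mem_of_mem_insert_of_ne hb hbe) hbad
        · rcases eq_or_ne b e with rfl | hb
          · simp [hweight, hJe]
          · simp [hb]
      · have hJsub : J ⊆ e.1.2 := Finset.filter_subset _ _
        have hJss : J ⊂ e.1.2 := by
          obtain ⟨k, hk, hwk⟩ := he
          refine Finset.ssubset_iff_subset_ne.2 ⟨hJsub, fun heq => ?_⟩
          rw [← heq, hJ, Finset.mem_filter] at hk
          linarith [hk.2]
        let e' : BLink N := ⟨(e.1.1, J), fun h => e.2.1 (hJsub h), hJne⟩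
        -- The target `e'` has no negatively weighted addressee, so moving traffic to it does not
        -- refill a broadcast that was emptied before.
        have hne : e ≠ e' := fun h => hJss.ne (congrArg (fun b : BLink N => b.1.2) h).symm
        have he' : ¬∃ k ∈ e'.1.2, w k e'.1.1 < 0 := by
          rintro ⟨k, hk, hwk⟩
          have := (Finset.mem_filter.1 hk).2
          exact absurd hwk (not_lt.2 this)
        refine ⟨moveTo f' e e', hdrop c f' hf' e e' rfl hJss, fun b hb hbad => ?_, hle.trans ?_⟩
        · have hbe' : b ≠ e' := fun h => he' (h ▸ hbad)
          rw [moveTo_apply f' hne]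
          rcases eq_or_ne b e with rfl | hbe
          · simp [hne]
          · simpa [hbe, hbe'] using hs b (Finset.mem_of_mem_insert_of_ne hb hbe) hbad
        · have hwe : broadcastWeight w' e' = broadcastWeight w' e := hweight.symm
          simp only [moveTo_apply f' hne, mul_sub, mul_add, Finset.sum_sub_distrib,
            Finset.sum_add_distrib, mul_ite, mul_zero, Finset.sum_ite_eq', mem_univ, if_true, hwe]
          linarith
  obtain ⟨f', hf', hbad, hle⟩ := hind univ
  refine ⟨f', hf', hle.trans (Finset.sum_le_sum fun b _ => ?_)⟩
  by_cases hb : ∃ k ∈ b.1.2, w k b.1.1 < 0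
  · simp [hbad b (mem_univ b) hb]
  · push Not at hb
    have : broadcastWeight w' b = broadcastWeight w b :=
      Finset.sum_congr rfl fun k hk => max_eq_left (hb k hk)
    rw [this]

/-- The local rates that are served by average broadcast rates in `A`. -/
def servedRates (A : Set (BLink N → ℝ)) : Set (ULink N → ℝ) :=
  {v | 0 ≤ v ∧ ∃ f ∈ A, ∀ e : ULink N, v e ≤ linkRate f e.1.1 e.1.2}

theorem linkRate_mono {f f' : BLink N → ℝ} (h : f ≤ f') (k n : N) :
    linkRate f k n ≤ linkRate f' k n := by
  refine Finset.sum_le_sum fun b _ => ?_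
  split_ifs
  · exact h b
  · exact le_rfl

theorem linkRate_nonneg {f : BLink N → ℝ} (h : 0 ≤ f) (k n : N) : 0 ≤ linkRate f k n := by
  refine Finset.sum_nonneg fun b _ => ?_
  split_ifs
  · exact h b
  · exact le_rfl

theorem linkRate_combo (a b : ℝ) (f f' : BLink N → ℝ) (k n : N) :
    linkRate (a • f + b • f') k n = a * linkRate f k n + b * linkRate f' k n := by
  simp only [linkRate, Finset.mul_sum, ← Finset.sum_add_distrib]
  refine Finset.sum_congr rfl fun e _ => ?_
  split_ifs <;> simp

theorem continuous_linkRate (k n : N) : Continuous fun f : BLink N → ℝ => linkRate f k n := by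
  refine continuous_finsetSum _ fun b _ => ?_
  split_ifs <;> fun_prop

theorem convex_servedRates {A : Set (BLink N → ℝ)} (hA : Convex ℝ A) :
    Convex ℝ (servedRates A) := by
  rintro v ⟨hv, f, hf, hvf⟩ v' ⟨hv', f', hf', hvf'⟩ a b ha hb hab
  refine ⟨fun e => ?_, _, hA hf hf' ha hb hab, fun e => ?_⟩
  · have h1 := hv e
    have h2 := hv' e
    simp only [Pi.zero_apply] at h1 h2
    simp only [Pi.zero_apply, Pi.add_apply, Pi.smul_apply, smul_eq_mul]
    positivity
  · have h1 := hvf e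
    have h2 := hvf' e
    rw [linkRate_combo]
    simp only [Pi.add_apply, Pi.smul_apply, smul_eq_mul]
    gcongr

/-- Served rates lie between `0` and the link rates of `G`, so the set is the projection of a
compact set of pairs. -/
theorem isClosed_servedRates {A : Set (BLink N → ℝ)} (hA : IsCompact A) {G : BLink N → ℝ}
    (hG : ∀ f ∈ A, f ≤ G) : IsClosed (servedRates A) := by
  have h1 : IsClosed {p : (ULink N → ℝ) × (BLink N → ℝ) | 0 ≤ p.1} :=
    isClosed_le continuous_const continuous_fst
  have h2 : ∀ e : ULink N, IsClosed {p : (ULink N → ℝ) × (BLink N → ℝ) |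
      p.1 e ≤ linkRate p.2 e.1.1 e.1.2} := fun e =>
    isClosed_le (by fun_prop) ((continuous_linkRate _ _).comp continuous_snd)
  have h3 := hA.isClosed.preimage (continuous_snd (X := ULink N → ℝ))
  set Z := {p : (ULink N → ℝ) × (BLink N → ℝ) | 0 ≤ p.1} ∩
    ((⋂ e : ULink N, {p | p.1 e ≤ linkRate p.2 e.1.1 e.1.2}) ∩ Prod.snd ⁻¹' A) with hZ
  have hZc : IsClosed Z := h1.inter ((isClosed_iInter h2).inter h3)
  have hmem : ∀ p, p ∈ Z ↔ 0 ≤ p.1 ∧ (∀ e : ULink N, p.1 e ≤ linkRate p.2 e.1.1 e.1.2) ∧ p.2 ∈ A :=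
    fun p => by simp [hZ]
  have hZk : IsCompact Z := by
    refine ((isCompact_Icc (a := (0 : ULink N → ℝ))
      (b := fun e => linkRate G e.1.1 e.1.2)).prod hA).of_isClosed_subset hZc fun p hp => ?_
    obtain ⟨h0, hle, hp2⟩ := (hmem p).1 hp
    exact ⟨⟨h0, fun e => (hle e).trans (linkRate_mono (hG _ hp2) _ _)⟩, hp2⟩
  have himg : servedRates A = Prod.fst '' Z := by
    ext v
    constructor
    · rintro ⟨h0, f, hf, hle⟩
      exact ⟨(v, f), (hmem _).2 ⟨h0, hle, hf⟩, rfl⟩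
    · rintro ⟨p, hp, rfl⟩
      obtain ⟨h0, hle, hp2⟩ := (hmem p).1 hp
      exact ⟨h0, p.2, hp2, hle⟩
  rw [himg]
  exact (hZk.image continuous_fst).isClosed

theorem integral_linkRate {Ω : Type*} [MeasurableSpace Ω] {P : Measure Ω} {f : Ω → BLink N → ℝ}
    (hf : Integrable f P) (k n : N) :
    ∫ ω, linkRate (f ω) k n ∂P = linkRate (∫ ω, f ω ∂P) k n := by
  have hi : ∀ b : BLink N, Integrable (fun ω => if b.1.1 = n ∧ k ∈ b.1.2 then f ω b else 0) P := by
    intro b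
    split_ifs
    · exact hf.eval b
    · exact integrable_zero _ _ _
  simp only [linkRate]
  rw [integral_finsetSum _ fun b _ => hi b]
  refine Finset.sum_congr rfl fun b _ => ?_
  split_ifs
  · rw [integral_apply_of_integrable hf]
  · simp

end Broadcast

end DcC

/-! ### Both schedulers are optimal in expectation, and conclusion -/

namespace DcC

variable {N S W : Type*} [Fintype N] [DecidableEq N] [MeasurableSpace S] [MeasurableSpace W]
  {net : Network N S W} {ν : Measure ((N → S) × (ULink N → W))}
  {Ω : Type*} [mΩ : MeasurableSpace Ω] {M : ℝ} {P : Measure Ω} [IsProbabilityMeasure P]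
  {ℱ : Filtration ℕ mΩ} {C : ℕ → Ω → (N → S) × (ULink N → W)} {G : ℝ} {R : Run N Ω}

omit [Fintype N] [DecidableEq N] [IsProbabilityMeasure P] in
theorem IIDChannel.map_snd (hC : IIDChannel P ν C) (t : ℕ) :
    P.map (fun ω => (C t ω).2) = ν.map Prod.snd := by
  rw [← hC.law t, Measure.map_map measurable_snd (hC.measurable t)]
  rfl

theorem BoundedRun.optimalRun_unicast (h : BoundedRun net M P ℱ C G R) (hC : IIDChannel P ν C)
    (hS : CellScheduler net C R) (hcell : ∀ k, IsRateRegion (net.cell k))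
    (huni : IsRateRegion net.uni) (hU : UnicastScheduler net C R) :
    OptimalRun net M P ℱ C G (avgRegion (ν.map Prod.fst) net.cellVec)
      (avgRegion (ν.map Prod.snd) net.uni) R where
  toBoundedRun := h
  cell_opt t _ _ hr hg := h.integral_cellObjective_le hC hS hcell t hr hg
  cell_mem t := h.exists_cell_mem hC hS hcell t
  local_opt t v hv := h.causal.integral_sum_mul_le hC t measurable_snd hv
    (c := fun ω e => R.lam t ω e.1.1 - R.eta t ω e.1.2 e.1.1 + R.Q t ω e.1.2 e.1.1)
    (fun e => measurable_weight (h.causal.lam_meas t) (h.causal.eta_meas t)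
      (h.causal.Q_meas t) _ _)
    (h.integrable_weight t)
    (h.integrable_uniObjective t (fun e => h.measurable_gl t _ _) fun ω e => h.gl_mem t ω _ _ e.2)
    fun ω x hx => isMaxOn_iff.1 (hU t ω).2 x hx
  local_mem t := by
    have hmem := huni.integral_mem_avgRegion (P := P) (measurable_snd.comp (hC.measurable t))
      (g := fun ω (e : ULink N) => R.gl t ω e.1.1 e.1.2)
      (measurable_pi_lambda _ fun e => h.measurable_gl t _ _) fun ω => (hU t ω).1
    rw [← hC.map_snd t]
    convert! hmem using 1
    ext e
    rw [integral_apply_of_integrable (Integrable.of_eval fun e => h.integrable_gl t e.2)]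

theorem BoundedRun.optimalRun_broadcast (h : BoundedRun net M P ℱ C G R) (hC : IIDChannel P ν C)
    (hS : CellScheduler net C R) (hcell : ∀ k, IsRateRegion (net.cell k))
    (hbro : IsRateRegion net.bro) (hdrop : CanDropAddressees net.bro)
    (hB : BroadcastScheduler net C R) :
    OptimalRun net M P ℱ C G (avgRegion (ν.map Prod.fst) net.cellVec)
      (servedRates (avgRegion (ν.map Prod.snd) net.bro)) R := by
  obtain ⟨f, hfm, hf⟩ := hB
  have hgl : ∀ t ω, (fun e : ULink N => R.gl t ω e.1.1 e.1.2) =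
      fun e : ULink N => linkRate (f t ω) e.1.1 e.1.2 := fun t ω =>
    funext fun e => (hf t ω).2.2 _ _ e.2
  refine ⟨h, fun t _ _ hr hg => h.integral_cellObjective_le hC hS hcell t hr hg,
    fun t v hv => ?_, fun t => h.exists_cell_mem hC hS hcell t, fun t => ?_⟩
  · obtain ⟨hv0, φ, hφ, hvφ⟩ := hv
    have hpos : ∀ e : ULink N, Integrable (fun ω =>
        max (R.lam t ω e.1.1 - R.eta t ω e.1.2 e.1.1 + R.Q t ω e.1.2 e.1.1) 0) P := fun e =>
      (h.integrable_weight t e).pos_part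
    have hci : ∀ b : BLink N, Integrable (fun ω => broadcastWeight
        (fun k n => max (R.lam t ω k - R.eta t ω n k + R.Q t ω n k) 0) b) P := fun b =>
      integrable_finsetSum _ fun k hk => hpos ⟨(k, b.1.1), fun hkn : k = b.1.1 => b.2.1 (hkn ▸ hk)⟩
    have hobj := h.integrable_uniObjective t (fun e => h.measurable_gl t _ _)
      fun ω e => h.gl_mem t ω _ _ e.2
    -- As `v` is only dominated by the link rates of `φ`, the comparison `w v ≤ w · linkRate φ` can
    -- fail for negative weights. It holds with positive parts, and the scheduler attains at least
    -- their value by dropping addressees.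
    have key := h.causal.integral_sum_mul_le hC t measurable_snd hφ
      (c := fun ω b => broadcastWeight
        (fun k n => max (R.lam t ω k - R.eta t ω n k + R.Q t ω n k) 0) b)
      (fun b => Finset.measurable_fun_sum _ fun k _ => Measurable.max
        (measurable_weight (h.causal.lam_meas t) (h.causal.eta_meas t) (h.causal.Q_meas t) _ _)
        measurable_const)
      hci hobj fun ω x hx => by
        obtain ⟨x', hx', hle⟩ := exists_drop_addressees hbro hdrop
          (fun k n => R.lam t ω k - R.eta t ω n k + R.Q t ω n k) hx
        have hmax := isMaxOn_iff.1 (hf t ω).2.1 x' hx'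
        rw [← uniObjective_eq, ← uniObjective_eq] at hmax
        rw [hgl]
        refine hle.trans (le_trans (le_of_eq ?_) hmax)
        exact (sum_mul_linkRate (fun k n => R.lam t ω k - R.eta t ω n k + R.Q t ω n k) x').symm
    refine le_trans ?_ key
    refine integral_mono (integrable_finsetSum _ fun e _ =>
        (h.integrable_weight t e).mul_const _)
      (integrable_finsetSum _ fun b _ => (hci b).mul_const _) fun ω => ?_
    simp only
    rw [← sum_mul_linkRate]
    refine Finset.sum_le_sum fun e _ => ?_
    calc (R.lam t ω e.1.1 - R.eta t ω e.1.2 e.1.1 + R.Q t ω e.1.2 e.1.1) * v e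
        ≤ max (R.lam t ω e.1.1 - R.eta t ω e.1.2 e.1.1 + R.Q t ω e.1.2 e.1.1) 0 * v e :=
          mul_le_mul_of_nonneg_right (le_max_left _ _) (hv0 e)
      _ ≤ _ := mul_le_mul_of_nonneg_left (hvφ e) (le_max_right _ _)
  · have hmem := hbro.integral_mem_avgRegion (P := P) (measurable_snd.comp (hC.measurable t))
      (hfm t) fun ω => (hf t ω).1
    obtain ⟨F, hF⟩ := hbro.bounded
    have hfi : Integrable (f t) P := Integrable.of_eval fun b =>
      integrable_of_mem_Icc (b := F b) ((measurable_pi_apply b).comp (hfm t))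
        fun ω => ⟨hbro.nonneg _ _ (hf t ω).1 b, hF _ _ (hf t ω).1 b⟩
    rw [← hC.map_snd t]
    refine ⟨fun e => integral_nonneg fun ω => (h.gl_mem t ω _ _ e.2).1, _, hmem, fun e => ?_⟩
    rw [← integral_linkRate hfi]
    exact (integral_congr_ae (Eventually.of_forall fun ω => congrFun (hgl t ω) e)).le

omit [IsProbabilityMeasure P] in
theorem IsRun.boundedRun (h : IsRun net ν M P ℱ C R) (hβ : 0 ≤ net.β)
    (hRG : ∀ k, net.Rmax k ≤ G) (hcell : ∀ k s, ∀ x ∈ net.cell k s, x ≤ G)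
    (hgl : ∀ t ω (e : ULink N), R.gl t ω e.1.1 e.1.2 ∈ Set.Icc 0 G) :
    BoundedRun net M P ℱ C G R where
  causal := h.causal
  dynamics := h.dynamics
  rate := h.rate
  beta_nonneg := hβ
  rate_le := hRG
  gs_mem t ω k n := mem_Icc_of_mem_cellChoices (hcell k _) (h.cellular t ω k).1 n
  gl_mem t ω k n hkn := hgl t ω ⟨(k, n), hkn⟩

omit [DecidableEq N] [MeasurableSpace W] in
/-- A common bound of all rates. -/
theorem exists_rate_bound (hcell : ∀ k, IsRateRegion (net.cell k)) (Gl : ULink N → ℝ) :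
    ∃ G, (∀ k, net.Rmax k ≤ G) ∧ (∀ k s, ∀ x ∈ net.cell k s, x ≤ G) ∧ ∀ e, Gl e ≤ G := by
  choose Gc hGc using fun k => (hcell k).bounded
  obtain ⟨a, ha⟩ := (Set.finite_range net.Rmax).bddAbove
  obtain ⟨b, hb⟩ := (Set.finite_range Gc).bddAbove
  obtain ⟨c, hc⟩ := (Set.finite_range Gl).bddAbove
  refine ⟨max a (max b c), fun k => ?_, fun k s x hx => ?_, fun e => ?_⟩
  · exact (ha ⟨k, rfl⟩).trans (le_max_left _ _)
  · exact ((hGc k s x hx).trans (hb ⟨k, rfl⟩)).trans ((le_max_left _ _).trans (le_max_right _ _))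
  · exact (hc ⟨e, rfl⟩).trans ((le_max_right _ _).trans (le_max_right _ _))

omit [DecidableEq N] [MeasurableSpace S] [MeasurableSpace W] in
theorem isUtilityOptimal_iff_eq {Feasible : (N → ℝ) → Prop} {F : Set (N → ℝ)}
    (hF : ∀ z, Feasible z ↔ z ∈ F) {y : N → ℝ} (hy : y ∈ F)
    (hmax : ∀ z ∈ F, ∑ k, net.U k (z k) ≤ ∑ k, net.U k (y k))
    (huniq : ∀ z ∈ F, ∑ k, net.U k (y k) ≤ ∑ k, net.U k (z k) → z = y) (z : N → ℝ) :
    IsUtilityOptimal net Feasible z ↔ z = y := by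
  constructor
  · rintro ⟨hz, hle⟩
    exact huniq z ((hF z).1 hz) (hle y ((hF y).2 hy))
  · rintro rfl
    exact ⟨(hF z).2 hy, fun x hx => hmax x ((hF x).1 hx)⟩

theorem broadcastFeasible_iff {νc : Measure (N → S)} {νw : Measure (ULink N → W)}
    (hcell : ∀ k, IsRateRegion (net.cell k)) (y : N → ℝ) :
    BroadcastFeasible net νc νw y ↔
      y ∈ feasibleRates (avgRegion νc net.cellVec) (servedRates (avgRegion νw net.bro)) := by
  rw [← exists_commonConstraints_iff hcell]
  constructor
  · rintro ⟨gs, gl, f, h, hle, hf⟩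
    exact ⟨gs, gl, h, fun e => h.gl_nonneg _ _ e.2, f, hf, fun e => hle _ _ e.2⟩
  · rintro ⟨gs, gl, h, -, f, hf, hle⟩
    exact ⟨gs, gl, f, h, fun k n hkn => hle ⟨(k, n), hkn⟩, hf⟩

end DcC

theorem theorem2 {N S W : Type*} [Fintype N] [DecidableEq N] [MeasurableSpace S]
    [MeasurableSpace W] (net : DcC.Network N S W)
    (ν : Measure ((N → S) × (DcC.ULink N → W))) [IsProbabilityMeasure ν]
    (hcell : ∀ k, DcC.IsRateRegion (net.cell k))
    (hU : ∀ k, StrictConcaveOn ℝ (Set.Ici 0) (net.U k))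
    (hUc : ∀ k, ContinuousOn (net.U k) (Set.Ici 0))
    (hR : ∀ k, ∀ r ∈ DcC.avgRegion (ν.map Prod.fst) net.cellVec, ∑ n, r n ≤ net.Rmax k)
    (hβ : 0 < net.β) :
    (DcC.IsRateRegion net.uni →
      ∃ yopt : N → ℝ,
        (∀ y, DcC.IsUtilityOptimal net
          (DcC.UnicastFeasible net (ν.map Prod.fst) (ν.map Prod.snd)) y ↔ y = yopt) ∧
        ∀ ε > 0, ∃ M₀ > 0, ∀ M ≥ M₀,
          ∀ (Ω : Type*) [mΩ : MeasurableSpace Ω] (P : Measure Ω) [IsProbabilityMeasure P]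
            (ℱ : Filtration ℕ mΩ) (C : ℕ → Ω → (N → S) × (DcC.ULink N → W)) (R : DcC.Run N Ω),
            DcC.IsRun net ν M P ℱ C R → DcC.UnicastScheduler net C R →
            ∀ᶠ T in atTop, ∀ k, |DcC.avgAdmitted P R T k - yopt k| ≤ ε) ∧
    (DcC.IsRateRegion net.bro → DcC.CanDropAddressees net.bro →
      ∃ yopt : N → ℝ,
        (∀ y, DcC.IsUtilityOptimal net
          (DcC.BroadcastFeasible net (ν.map Prod.fst) (ν.map Prod.snd)) y ↔ y = yopt) ∧
        ∀ ε > 0, ∃ M₀ > 0, ∀ M ≥ M₀,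
          ∀ (Ω : Type*) [mΩ : MeasurableSpace Ω] (P : Measure Ω) [IsProbabilityMeasure P]
            (ℱ : Filtration ℕ mΩ) (C : ℕ → Ω → (N → S) × (DcC.ULink N → W)) (R : DcC.Run N Ω),
            DcC.IsRun net ν M P ℱ C R → DcC.BroadcastScheduler net C R →
            ∀ᶠ T in atTop, ∀ k, |DcC.avgAdmitted P R T k - yopt k| ≤ ε) := by
  have hc : IsProbabilityMeasure (ν.map Prod.fst) :=
    Measure.isProbabilityMeasure_map measurable_fst.aemeasurable
  have hw : IsProbabilityMeasure (ν.map Prod.snd) :=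
    Measure.isProbabilityMeasure_map measurable_snd.aemeasurable
  have hvec := DcC.isRateRegion_cellVec hcell
  constructor
  · intro huni
    obtain ⟨F, hF⟩ := huni.bounded
    -- This bound comes from the data of the system alone, and hence so does the threshold for `M`.
    obtain ⟨G, hGR, hGc, hGl⟩ := DcC.exists_rate_bound hcell F
    obtain ⟨y, hy, hmax, huniq, hy_near⟩ := DcC.exists_optimum_and_threshold hU hUc hR
      DcC.convex_avgRegion hvec.isCompact_avgRegion hvec.zero_mem_avgRegion
      (L := DcC.avgRegion (ν.map Prod.snd) net.uni) DcC.convex_avgRegion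
      huni.isClosed_avgRegion huni.zero_mem_avgRegion G
    refine ⟨y, DcC.isUtilityOptimal_iff_eq
      (fun z => DcC.exists_commonConstraints_iff hcell z) hy hmax huniq, fun ε hε => ?_⟩
    obtain ⟨δ, hδ, M₀, hM₀, hM⟩ := hy_near ε hε
    refine ⟨M₀, hM₀, fun M hMM Ω mΩ P _ ℱ C R hrun hS => ?_⟩
    have hb := hrun.boundedRun hβ.le hGR hGc fun t ω e =>
      ⟨huni.nonneg _ _ (hS t ω).1 e, (hF _ _ (hS t ω).1 e).trans (hGl e)⟩
    exact (hb.optimalRun_unicast hrun.channel hrun.cellular hcell huni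
      hS).eventually_abs_avgAdmitted_sub_le (fun k => (hU k).concaveOn) hUc hR
      DcC.convex_avgRegion DcC.convex_avgRegion
      (fun v hv w h0 hle => huni.lower_avgRegion hv h0 hle) hy hδ (hM M hMM)
  · intro hbro hdrop
    obtain ⟨F, hF⟩ := hbro.bounded
    obtain ⟨A, hA⟩ := hbro.avgRegion_le (ν := ν.map Prod.snd)
    obtain ⟨G, hGR, hGc, hGl⟩ := DcC.exists_rate_bound hcell
      fun e : DcC.ULink N => DcC.linkRate F e.1.1 e.1.2
    obtain ⟨y, hy, hmax, huniq, hy_near⟩ := DcC.exists_optimum_and_threshold hU hUc hR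
      DcC.convex_avgRegion hvec.isCompact_avgRegion hvec.zero_mem_avgRegion
      (L := DcC.servedRates (DcC.avgRegion (ν.map Prod.snd) net.bro))
      (DcC.convex_servedRates DcC.convex_avgRegion)
      (DcC.isClosed_servedRates hbro.isCompact_avgRegion fun f hf => (hA hf).2)
      ⟨le_rfl, 0, hbro.zero_mem_avgRegion, fun e => DcC.linkRate_nonneg le_rfl _ _⟩ G
    refine ⟨y, DcC.isUtilityOptimal_iff_eq
      (fun z => DcC.broadcastFeasible_iff hcell z) hy hmax huniq, fun ε hε => ?_⟩
    obtain ⟨δ, hδ, M₀, hM₀, hM⟩ := hy_near ε hε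
    refine ⟨M₀, hM₀, fun M hMM Ω mΩ P _ ℱ C R hrun hS => ?_⟩
    have hgl : ∀ t ω (e : DcC.ULink N), R.gl t ω e.1.1 e.1.2 ∈ Set.Icc 0 G := by
      obtain ⟨f, -, hf⟩ := hS
      intro t ω e
      obtain ⟨hmem, -, heq⟩ := hf t ω
      rw [heq _ _ e.2]
      exact ⟨DcC.linkRate_nonneg (hbro.nonneg _ _ hmem) _ _,
        (DcC.linkRate_mono (hF _ _ hmem) _ _).trans (hGl e)⟩
    have hb := hrun.boundedRun hβ.le hGR hGc hgl
    exact (hb.optimalRun_broadcast hrun.channel hrun.cellular hcell hbro hdrop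
      hS).eventually_abs_avgAdmitted_sub_le (fun k => (hU k).concaveOn) hUc hR
      DcC.convex_avgRegion (DcC.convex_servedRates DcC.convex_avgRegion)
      (fun v hv w h0 hle => ⟨h0, hv.2.imp fun f hf =>
        ⟨hf.1, fun e => (hle e).trans (hf.2 e)⟩⟩) hy hδ (hM M hMM)
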